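/- Let $d,n\ge 1$ be integers, $\sigma\in(0,\infty)$, $p\in(2,\infty)$, $\delta\in(0,1/2)$, and let $e(t)=|t|^p/[p(p-1)]$ for $t\in\mathbb R$. Let $P_X$ be a probability distribution on $\mathbb R^d$ whose support is not contained in any hyperplane $\{x:\langle w,x\rangle=0\}$, $w\ne 0$, and such that $\mathbb E[e(\langle\Delta,X\rangle+\eta)]<\infty$ for every $\Delta\in\mathbb R^d$, where $(X,\eta)\sim P_X\times\mathcal N(0,\sigma^2)$. Let $\mathcal P_{\mathrm{Gauss}}(P_X,\sigma^2)$ be the set of all distributions of $(X,\langle w^*,X\rangle+\eta)$, $w^*\in\mathbb R^d$, with $(X,\eta)$ as above. For $P$ in this class and $(X,Y)\sim P$, put $E_P(w)=\mathbb E[e(\langle w,X\rangle-Y)]$ and $\mathcal E_P(w)=E_P(w)-\inf_{v\in\mathbb R^d}E_P(v)$. For a (measurable) procedure $\hat w:(\mathbb R^d\times\mathbb R)^n\to\mathbb R^d$ applied to an i.i.d. sample $D_n$ of size $n$ from $P$, define the quantile risk $$R_{n,\delta}(P,\hat w)=\inf\{t\ge 0:\ \mathbb P(\mathcal E_P(\hat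 w(D_n))\le t)\ge 1-\delta\}\in[0,\infty],$$ and the minimax quantile risk $$R^*_{n,\delta}(\mathcal P_{\mathrm{Gauss}}(P_X,\sigma^2))=\inf_{\hat w}\ \sup_{P\in\mathcal P_{\mathrm{Gauss}}(P_X,\sigma^2)}R_{n,\delta}(P,\hat w).$$ Then $$R^*_{n,\delta}(\mathcal P_{\mathrm{Gauss}}(P_X,\sigma^2))\ \ge\ \frac{m(p-2)}{16(p-1)}\cdot\frac{\sigma^p\,[d+\log(1/\delta)]}{n},$$ where $m(q)=\mathbb E[|Z|^q]$, $Z\sim\mathcal N(0,1)$, denotes the $q$-th absolute moment of a standard normal variable. -/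

import Mathlib

open MeasureTheory ProbabilityTheory
open scoped NNReal ENNReal

noncomputable section

namespace QuantileRegression

/-- Expected error `E(w) = 𝔼[e(⟨w, X⟩ - Y)]` of the linear predictor `w`, for `(X, Y) ∼ P`. -/
def expectedError {d : ℕ} (e : ℝ → ℝ) (P : Measure (EuclideanSpace ℝ (Fin d) × ℝ))
    (w : EuclideanSpace ℝ (Fin d)) : ℝ :=
  ∫ z, e (inner ℝ w z.1 - z.2) ∂P

/-- Excess expected error `ℰ(w) = E(w) - inf_v E(v)`. -/
def excessError {d : ℕ} (e : ℝ → ℝ) (P : Measure (EuclideanSpace ℝ (Fin d) × ℝ))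
    (w : EuclideanSpace ℝ (Fin d)) : ℝ :=
  expectedError e P w - ⨅ v : EuclideanSpace ℝ (Fin d), expectedError e P v

/-- Quantile risk of the procedure `what` under `P`: the infimum, in `[0, ∞]`, of the real `t ≥ 0`
such that `ℰ(what(D)) ≤ t` with probability at least `1 - δ`, where the sample `D` consists of `n`
independent draws from `P`. The infimum of the empty set is `∞`. -/
def quantileRisk {d : ℕ} (e : ℝ → ℝ) (n : ℕ) (δ : ℝ)
    (P : Measure (EuclideanSpace ℝ (Fin d) × ℝ))
    (what : (Fin n → EuclideanSpace ℝ (Fin d) × ℝ) → EuclideanSpace ℝ (Fin d)) : ℝ≥0∞ :=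
  ⨅ (t : ℝ≥0) (_ : ENNReal.ofReal (1 - δ) ≤
    Measure.pi (fun _ : Fin n => P) {D | excessError e P (what D) ≤ (t : ℝ)}), (t : ℝ≥0∞)

/-- Worst-case quantile risk of a procedure over a class of distributions. -/
def worstCaseRisk {d : ℕ} (e : ℝ → ℝ) (n : ℕ) (δ : ℝ)
    (Pcal : Set (Measure (EuclideanSpace ℝ (Fin d) × ℝ)))
    (what : (Fin n → EuclideanSpace ℝ (Fin d) × ℝ) → EuclideanSpace ℝ (Fin d)) : ℝ≥0∞ :=
  ⨆ P ∈ Pcal, quantileRisk e n δ P what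

/-- Minimax quantile risk over a class of distributions; procedures are the measurable maps from
samples to predictors. -/
def minimaxRisk {d : ℕ} (e : ℝ → ℝ) (n : ℕ) (δ : ℝ)
    (Pcal : Set (Measure (EuclideanSpace ℝ (Fin d) × ℝ))) : ℝ≥0∞ :=
  ⨅ (what : (Fin n → EuclideanSpace ℝ (Fin d) × ℝ) → EuclideanSpace ℝ (Fin d))
    (_ : Measurable what), worstCaseRisk e n δ Pcal what

/-- The class of laws of `(X, ⟨wstar, X⟩ + η)`, where `(X, η) ∼ PX × 𝒩(0, σ²)` and `wstar` ranges
over `ℝ^d`. -/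
def gaussClass {d : ℕ} (PX : Measure (EuclideanSpace ℝ (Fin d))) (σ : ℝ≥0) :
    Set (Measure (EuclideanSpace ℝ (Fin d) × ℝ)) :=
  {P | ∃ wstar : EuclideanSpace ℝ (Fin d),
    P = (PX.prod (gaussianReal 0 (σ ^ 2))).map (fun z => (z.1, inner ℝ wstar z.1 + z.2))}

/-- The `p`-th power error function `e(t) = |t|^p / (p (p - 1))`. -/
def powerError (p : ℝ) (t : ℝ) : ℝ := |t| ^ p / (p * (p - 1))

/-- The `q`-th absolute moment of a standard normal variable. -/
def absMoment (q : ℝ) : ℝ := ∫ z, |z| ^ q ∂(gaussianReal 0 1)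

end QuantileRegression

end

noncomputable section

namespace QuantileRegression

/-! ### Likelihood ratios -/

/-! Bernoulli's inequality bounds the excess error below by κ 𝔼⟨wstar - w, X⟩², where κ = m(p-2)
σ^(p-2) / (2(p-1)) (`le_excessError`). Writing the second-moment form as ‖G w‖² with G invertible
turns the problem into estimating θ = G wstar in a Gaussian linear model with isotropic features. A
risk below the claimed bound would give an estimator within √t of every θ with probability at least
1 - δ, where v = σ², L = log(1/δ) and t = v(d + L)/(8n). `not_isAccurate` excludes this by playing
two bounds against each other.

The two-point bound (`IsAccurate.exp_neg_le`) forces 3L ≤ d + 8 log 2, so L is at most of order d.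
The Bayesian bound (`IsAccurate.one_sub_le`) uses a Gaussian prior. The posterior is Gaussian, and
its density is at most (s/2π)^(d/2), where s is the trace of the posterior precision divided by d.
Hence a ball of radius √t has posterior mass at most min(1, vol · (s/2π)^(d/2)). This is bounded by
an affine function of s, because the mean of s is known exactly whatever the law of X. Flattening
the prior gives an inequality that contradicts the bound on L numerically. -/

lemma pi_withDensity {ι α : Type*} [Fintype ι] [MeasurableSpace α] (μ : Measure α)
    [IsProbabilityMeasure μ] {g : α → ℝ≥0∞} (hg : Measurable g)
    [SigmaFinite (μ.withDensity g)] :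
    Measure.pi (fun _ : ι => μ.withDensity g)
      = (Measure.pi fun _ : ι => μ).withDensity fun D => ∏ i, g (D i) := by
  refine Measure.pi_eq fun s hs => ?_
  rw [withDensity_apply _ (MeasurableSet.univ_pi hs),
    ← lintegral_indicator (MeasurableSet.univ_pi hs)]
  have h1 : (Set.univ.pi s).indicator (fun D : ι → α => ∏ i, g (D i))
      = fun D => ∏ i, (s i).indicator g (D i) := by
    classical
    funext D
    by_cases hD : D ∈ Set.univ.pi s
    · rw [Set.indicator_of_mem hD]
      exact Finset.prod_congr rfl fun i _ => (Set.indicator_of_mem (hD i trivial) g).symm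
    · rw [Set.indicator_of_notMem hD]
      simp only [Set.mem_pi, Set.mem_univ, true_imp_iff, not_forall] at hD
      obtain ⟨i, hi⟩ := hD
      exact (Finset.prod_eq_zero (Finset.mem_univ i) (Set.indicator_of_notMem hi g)).symm
  rw [h1, lintegral_prod_eq_prod_lintegral_of_indepFun Finset.univ
    (fun i (D : ι → α) => (s i).indicator g (D i))
    (iIndepFun_pi (μ := fun _ => μ) (X := fun i => (s i).indicator g)
      fun i => (hg.indicator (hs i)).aemeasurable)
    fun i => (hg.indicator (hs i)).comp (measurable_pi_apply i)]
  refine Finset.prod_congr rfl fun i _ => ?_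
  rw [(measurePreserving_eval (fun _ : ι => μ) i).lintegral_comp (hg.indicator (hs i)),
    lintegral_indicator (hs i), withDensity_apply _ (hs i)]

/-- Cameron–Martin formula on the line: after translating Lebesgue measure by -a, it is an identity
between Gaussian densities. -/
lemma lintegral_const_add_gaussianReal {v : ℝ≥0} (hv : v ≠ 0) (a : ℝ) {f : ℝ → ℝ≥0∞}
    (hf : Measurable f) :
    ∫⁻ y, f (a + y) ∂(gaussianReal 0 v)
      = ∫⁻ y, ENNReal.ofReal (Real.exp ((y * a - a ^ 2 / 2) / v)) * f y ∂(gaussianReal 0 v) := by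
  have hv' : (v : ℝ) ≠ 0 := by exact_mod_cast hv
  rw [gaussianReal_of_var_ne_zero 0 hv,
    lintegral_withDensity_eq_lintegral_mul _ (measurable_gaussianPDF 0 v) (by fun_prop),
    lintegral_withDensity_eq_lintegral_mul _ (measurable_gaussianPDF 0 v) (by fun_prop),
    ← lintegral_add_left_eq_self _ (-a)]
  refine lintegral_congr fun y => ?_
  simp only [Pi.mul_apply, add_neg_cancel_left, gaussianPDF]
  rw [← mul_assoc, ← ENNReal.ofReal_mul (gaussianPDFReal_nonneg _ _ _)]
  congr 2
  simp only [gaussianPDFReal]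
  rw [mul_assoc _ (Real.exp _), ← Real.exp_add]
  congr 2
  field_simp
  ring

variable {d n : ℕ} {α : Type*} [MeasurableSpace α]

/-- Law of `(x, ⟨θ, φ x⟩ + η)` for `(x, η) ∼ PX × 𝒩(0, v)`. -/
def shiftedLaw (PX : Measure α) (v : ℝ≥0) (φ : α → EuclideanSpace ℝ (Fin d))
    (θ : EuclideanSpace ℝ (Fin d)) : Measure (α × ℝ) :=
  (PX.prod (gaussianReal 0 v)).map fun z => (z.1, inner ℝ θ (φ z.1) + z.2)

/-- Log-likelihood ratio of the sample `D` under `shiftedLaw PX v φ θ` against `θ = 0`. -/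
def logLik (v : ℝ≥0) (φ : α → EuclideanSpace ℝ (Fin d)) (D : Fin n → α × ℝ)
    (θ : EuclideanSpace ℝ (Fin d)) : ℝ :=
  ∑ i, ((D i).2 * inner ℝ θ (φ (D i).1) - (inner ℝ θ (φ (D i).1)) ^ 2 / 2) / v

lemma isProbabilityMeasure_shiftedLaw (PX : Measure α) [IsProbabilityMeasure PX] (v : ℝ≥0)
    {φ : α → EuclideanSpace ℝ (Fin d)} (hφ : Measurable φ) (θ : EuclideanSpace ℝ (Fin d)) :
    IsProbabilityMeasure (shiftedLaw PX v φ θ) :=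
  Measure.isProbabilityMeasure_map (by fun_prop)

lemma shiftedLaw_eq_withDensity (PX : Measure α) [IsProbabilityMeasure PX] {v : ℝ≥0} (hv : v ≠ 0)
    {φ : α → EuclideanSpace ℝ (Fin d)} (hφ : Measurable φ) (θ : EuclideanSpace ℝ (Fin d)) :
    shiftedLaw PX v φ θ = (PX.prod (gaussianReal 0 v)).withDensity fun z =>
      ENNReal.ofReal (Real.exp ((z.2 * inner ℝ θ (φ z.1) - (inner ℝ θ (φ z.1)) ^ 2 / 2) / v)) := by
  refine Measure.ext_of_lintegral _ fun f hf => ?_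
  have hm : Measurable fun z : α × ℝ => ENNReal.ofReal
      (Real.exp ((z.2 * inner ℝ θ (φ z.1) - (inner ℝ θ (φ z.1)) ^ 2 / 2) / v)) := by fun_prop
  rw [shiftedLaw, lintegral_map hf (by fun_prop), lintegral_prod _ (by fun_prop),
    lintegral_withDensity_eq_lintegral_mul _ hm hf, lintegral_prod _ (hm.mul hf).aemeasurable]
  refine lintegral_congr fun x => ?_
  exact lintegral_const_add_gaussianReal hv (inner ℝ θ (φ x)) (f := fun y => f (x, y)) (by fun_prop)

lemma pi_shiftedLaw_eq_withDensity (PX : Measure α) [IsProbabilityMeasure PX] {v : ℝ≥0}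
    (hv : v ≠ 0) {φ : α → EuclideanSpace ℝ (Fin d)} (hφ : Measurable φ)
    (θ : EuclideanSpace ℝ (Fin d)) :
    Measure.pi (fun _ : Fin n => shiftedLaw PX v φ θ)
      = (Measure.pi fun _ : Fin n => PX.prod (gaussianReal 0 v)).withDensity fun D =>
        ENNReal.ofReal (Real.exp (logLik v φ D θ)) := by
  have hP := isProbabilityMeasure_shiftedLaw PX v hφ θ
  rw [shiftedLaw_eq_withDensity PX hv hφ θ] at hP ⊢
  rw [pi_withDensity _ (by fun_prop)]
  congr 1
  funext D
  rw [logLik, Real.exp_sum, ENNReal.ofReal_prod_of_nonneg fun i _ => (Real.exp_pos _).le]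

@[fun_prop]
lemma measurable_logLik {v : ℝ≥0} {φ : α → EuclideanSpace ℝ (Fin d)} (hφ : Measurable φ) :
    Measurable fun z : (Fin n → α × ℝ) × EuclideanSpace ℝ (Fin d) => logLik v φ z.1 z.2 := by
  unfold logLik
  fun_prop


/-! ### Gaussian integrals of quadratic exponentials -/

lemma ofReal_integral_le_lintegral_ofReal {α : Type*} [MeasurableSpace α] {μ : Measure α}
    {f : α → ℝ} (hf : Integrable f μ) :
    ENNReal.ofReal (∫ x, f x ∂μ) ≤ ∫⁻ x, ENNReal.ofReal (f x) ∂μ := by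
  rw [integral_eq_lintegral_pos_part_sub_lintegral_neg_part hf]
  refine (ENNReal.ofReal_le_ofReal (sub_le_self _ ENNReal.toReal_nonneg)).trans ?_
  exact ENNReal.ofReal_toReal_le

section
variable {V : Type*} [NormedAddCommGroup V] [InnerProductSpace ℝ V] [FiniteDimensional ℝ V]
  [MeasurableSpace V] [BorelSpace V]

lemma integrable_exp_neg_mul_sq_norm {b : ℝ} (hb : 0 < b) :
    Integrable fun x : V => Real.exp (-b * ‖x‖ ^ 2) := by
  have h := (GaussianFourier.integrable_cexp_neg_mul_sq_norm_add (V := V) (b := (b : ℂ))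
    (by simpa using hb) 0 0).re
  refine h.congr (Filter.Eventually.of_forall fun x => ?_)
  simp only [zero_mul, add_zero]
  have : (-(b : ℂ) * (‖x‖ : ℂ) ^ 2) = ((-b * ‖x‖ ^ 2 : ℝ) : ℂ) := by push_cast; ring
  rw [this, ← Complex.ofReal_exp]
  exact Complex.ofReal_re _

lemma integrable_sq_norm_mul_exp {b : ℝ} (hb : 0 < b) :
    Integrable fun x : V => ‖x‖ ^ 2 * Real.exp (-b * ‖x‖ ^ 2) := by
  refine ((integrable_exp_neg_mul_sq_norm (V := V) (half_pos hb)).const_mul (2 / b)).mono'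
    (by fun_prop) (Filter.Eventually.of_forall fun x => ?_)
  rw [Real.norm_of_nonneg (by positivity)]
  have h1 : b / 2 * ‖x‖ ^ 2 ≤ Real.exp (b / 2 * ‖x‖ ^ 2) :=
    (le_add_of_nonneg_right zero_le_one).trans (Real.add_one_le_exp _)
  have h2 : ‖x‖ ^ 2 ≤ 2 / b * Real.exp (b / 2 * ‖x‖ ^ 2) := by
    rw [div_mul_eq_mul_div, le_div_iff₀ hb]; linarith
  calc ‖x‖ ^ 2 * Real.exp (-b * ‖x‖ ^ 2)
      ≤ 2 / b * Real.exp (b / 2 * ‖x‖ ^ 2) * Real.exp (-b * ‖x‖ ^ 2) := by gcongr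
    _ = 2 / b * Real.exp (-(b / 2) * ‖x‖ ^ 2) := by
      rw [mul_assoc, ← Real.exp_add]; ring_nf

lemma integrable_inner_sq_mul_exp {b : ℝ} (hb : 0 < b) (u : V) :
    Integrable fun x : V => (inner ℝ u x) ^ 2 * Real.exp (-b * ‖x‖ ^ 2) := by
  refine ((integrable_sq_norm_mul_exp (V := V) hb).const_mul (‖u‖ ^ 2)).mono'
    (by fun_prop) (Filter.Eventually.of_forall fun x => ?_)
  rw [Real.norm_of_nonneg (by positivity), ← mul_assoc, ← mul_pow]
  gcongr ?_ * _
  exact sq_le_sq' (by linarith [neg_abs_le (inner ℝ u x), abs_real_inner_le_norm u x])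
    (real_inner_le_norm u x)

lemma integrable_inner_mul_exp {b : ℝ} (hb : 0 < b) (u : V) :
    Integrable fun x : V => inner ℝ u x * Real.exp (-b * ‖x‖ ^ 2) := by
  refine ((integrable_inner_sq_mul_exp hb u).add (integrable_exp_neg_mul_sq_norm hb)).mono'
    (by fun_prop) (Filter.Eventually.of_forall fun x => ?_)
  rw [norm_mul, Real.norm_of_nonneg (Real.exp_pos _).le, Pi.add_apply, ← add_one_mul,
    Real.norm_eq_abs]
  gcongr
  nlinarith [sq_abs (inner ℝ u x), sq_nonneg (|inner ℝ u x| - 1), abs_nonneg (inner ℝ u x)]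

lemma integral_inner_mul_exp (b : ℝ) (u : V) :
    ∫ x : V, inner ℝ u x * Real.exp (-b * ‖x‖ ^ 2) = 0 := by
  have h := integral_neg_eq_self (fun x : V => inner ℝ u x * Real.exp (-b * ‖x‖ ^ 2)) volume
  simp only [inner_neg_right, norm_neg, neg_mul (inner ℝ u _) (Real.exp _), integral_neg] at h
  linarith

/-- The reflection exchanging u and w preserves both the norm and Lebesgue measure. -/
lemma integral_inner_sq_mul_exp_eq_of_norm_eq (b : ℝ) {u w : V} (h : ‖u‖ = ‖w‖) :
    ∫ x : V, (inner ℝ u x) ^ 2 * Real.exp (-b * ‖x‖ ^ 2)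
      = ∫ x : V, (inner ℝ w x) ^ 2 * Real.exp (-b * ‖x‖ ^ 2) := by
  let R := (ℝ ∙ (u - w))ᗮ.reflection
  have hR : R u = w := Submodule.reflection_sub h
  rw [← R.measurePreserving.integral_comp R.toHomeomorph.measurableEmbedding
    (fun x : V => (inner ℝ w x) ^ 2 * Real.exp (-b * ‖x‖ ^ 2))]
  refine integral_congr_ae (Filter.Eventually.of_forall fun x => ?_)
  simp only [LinearIsometryEquiv.norm_map]
  rw [← hR, LinearIsometryEquiv.inner_map_map]

/-- By rotational symmetry, u may be replaced by ‖u‖ times any vector of an orthonormal basis;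
summing over the basis restores ‖x‖². No Gaussian moment has to be computed. -/
lemma finrank_mul_integral_inner_sq_mul_exp {b : ℝ} (hb : 0 < b) (u : V) :
    Module.finrank ℝ V * ∫ x : V, (inner ℝ u x) ^ 2 * Real.exp (-b * ‖x‖ ^ 2)
      = ‖u‖ ^ 2 * ∫ x : V, ‖x‖ ^ 2 * Real.exp (-b * ‖x‖ ^ 2) := by
  let e := stdOrthonormalBasis ℝ V
  have h1 : ∀ x : V, ‖u‖ ^ 2 * (‖x‖ ^ 2 * Real.exp (-b * ‖x‖ ^ 2))
      = ∑ i, (inner ℝ (‖u‖ • e i) x) ^ 2 * Real.exp (-b * ‖x‖ ^ 2) := fun x => by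
    rw [← e.sum_sq_inner_right x, ← Finset.sum_mul, ← mul_assoc, Finset.mul_sum]
    simp_rw [real_inner_smul_left, mul_pow]
  rw [← integral_const_mul (‖u‖ ^ 2)]
  simp_rw [h1]
  rw [integral_finsetSum _ fun i _ => integrable_inner_sq_mul_exp hb _]
  rw [Finset.sum_congr rfl fun i _ => integral_inner_sq_mul_exp_eq_of_norm_eq b
    (show ‖‖u‖ • e i‖ = ‖u‖ by simp [norm_smul])]
  simp

/-- A concave quadratic `F` on `V` satisfies `exp (F θ₀) ≤ (s / 2π) ^ (d / 2) ∫ exp F`, where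
`d s` is the trace of the quadratic form of `F`. -/
lemma exp_quadratic_mul_le_lintegral {ι : Type*} [Fintype ι] (u : ι → V) (c l : ℝ) (w : V) {s : ℝ}
    (hs : 0 < s) (htr : Module.finrank ℝ V * l + ∑ i, ‖u i‖ ^ 2 = Module.finrank ℝ V * s)
    (hV : 0 < Module.finrank ℝ V) (θ₀ : V) :
    ENNReal.ofReal ((2 * Real.pi / s) ^ (Module.finrank ℝ V / 2 : ℝ)) * ENNReal.ofReal
        (Real.exp (c + inner ℝ w θ₀ - l * ‖θ₀‖ ^ 2 / 2 - (∑ i, (inner ℝ (u i) θ₀) ^ 2) / 2))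
      ≤ ∫⁻ θ, ENNReal.ofReal
        (Real.exp (c + inner ℝ w θ - l * ‖θ‖ ^ 2 / 2 - (∑ i, (inner ℝ (u i) θ) ^ 2) / 2)) := by
  set F : V → ℝ := fun θ =>
    c + inner ℝ w θ - l * ‖θ‖ ^ 2 / 2 - (∑ i, (inner ℝ (u i) θ) ^ 2) / 2 with hF
  -- The comparison weight exp(-b‖x‖²) is an isotropic Gaussian whose precision s is the averaged
  -- trace. This replaces det ≤ (tr/d)^d.
  set b := s / 2 with hb
  have hb0 : 0 < b := half_pos hs
  -- The gradient of F at θ₀; the expansion of F around θ₀ is exact.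
  set w' : V := w - l • θ₀ - ∑ i, (inner ℝ (u i) θ₀) • u i with hw'
  have hexp : ∀ x, F (θ₀ + x) = F θ₀ + (inner ℝ w' x - l * ‖x‖ ^ 2 / 2
      - (∑ i, (inner ℝ (u i) x) ^ 2) / 2) := fun x => by
    simp only [hF, hw', inner_add_right, inner_sub_left, sum_inner, real_inner_smul_left]
    rw [norm_add_sq_real]
    simp only [add_sq, Finset.sum_add_distrib]
    have : ∑ i, 2 * inner ℝ (u i) θ₀ * inner ℝ (u i) x
        = 2 * ∑ i, inner ℝ (u i) θ₀ * inner ℝ (u i) x := by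
      rw [Finset.mul_sum]; exact Finset.sum_congr rfl fun _ _ => by ring
    rw [this]
    ring
  set M := ∫ x : V, ‖x‖ ^ 2 * Real.exp (-b * ‖x‖ ^ 2) with hM
  have i0 := integrable_exp_neg_mul_sq_norm (V := V) hb0
  have i1 := integrable_inner_mul_exp hb0 w'
  have i2 := integrable_sq_norm_mul_exp (V := V) hb0
  have i3 : Integrable fun x : V => ∑ i, (inner ℝ (u i) x) ^ 2 * Real.exp (-b * ‖x‖ ^ 2) :=
    integrable_finsetSum _ fun i _ => integrable_inner_sq_mul_exp hb0 (u i)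
  -- With q = F(θ₀ + x) - F(θ₀), this is the weight times 1 + q + b‖x‖², a lower bound for exp q
  -- because exp y ≥ 1 + y. On integrating, the linear term vanishes by oddness and the quadratic
  -- terms cancel by `htr`.
  set G : V → ℝ := fun x => Real.exp (-b * ‖x‖ ^ 2) + inner ℝ w' x * Real.exp (-b * ‖x‖ ^ 2)
      + (s - l) / 2 * (‖x‖ ^ 2 * Real.exp (-b * ‖x‖ ^ 2))
      - 1 / 2 * ∑ i, (inner ℝ (u i) x) ^ 2 * Real.exp (-b * ‖x‖ ^ 2) with hG
  have i01 : Integrable fun x : V =>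
      Real.exp (-b * ‖x‖ ^ 2) + inner ℝ w' x * Real.exp (-b * ‖x‖ ^ 2) := i0.add i1
  have i012 : Integrable fun x : V =>
      Real.exp (-b * ‖x‖ ^ 2) + inner ℝ w' x * Real.exp (-b * ‖x‖ ^ 2)
        + (s - l) / 2 * (‖x‖ ^ 2 * Real.exp (-b * ‖x‖ ^ 2)) := i01.add (i2.const_mul _)
  have iG : Integrable G := i012.sub (i3.const_mul _)
  have hI : ∫ x, G x = (2 * Real.pi / s) ^ (Module.finrank ℝ V / 2 : ℝ) := by
    have e3 : ∫ x : V, ∑ i, (inner ℝ (u i) x) ^ 2 * Real.exp (-b * ‖x‖ ^ 2) = (s - l) * M := by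
      rw [integral_finsetSum _ fun i _ => integrable_inner_sq_mul_exp hb0 (u i)]
      have hd : (Module.finrank ℝ V : ℝ) ≠ 0 := by positivity
      apply mul_left_cancel₀ hd
      rw [Finset.mul_sum, Finset.sum_congr rfl fun i _ =>
        finrank_mul_integral_inner_sq_mul_exp hb0 (u i), ← Finset.sum_mul, ← hM, ← mul_assoc]
      congr 1
      linarith
    have e0 := GaussianFourier.integral_rexp_neg_mul_sq_norm (V := V) hb0
    simp only [hG]
    rw [integral_sub i012 (i3.const_mul _),
      integral_add i01 (i2.const_mul _), integral_add i0 i1, integral_const_mul,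
      integral_const_mul, e3, e0, integral_inner_mul_exp, ← hM, hb,
      show Real.pi / (s / 2) = 2 * Real.pi / s by field_simp]
    ring
  have hle : ∀ x, Real.exp (F θ₀) * G x ≤ Real.exp (F (θ₀ + x)) := fun x => by
    rw [hexp, Real.exp_add]
    refine mul_le_mul_of_nonneg_left ?_ (Real.exp_pos _).le
    set q := inner ℝ w' x - l * ‖x‖ ^ 2 / 2 - (∑ i, (inner ℝ (u i) x) ^ 2) / 2
    have h1 : G x = Real.exp (-b * ‖x‖ ^ 2) * (q + b * ‖x‖ ^ 2 + 1) := by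
      simp only [hG, q, hb, ← Finset.sum_mul]; ring
    rw [h1, show Real.exp q = Real.exp (-b * ‖x‖ ^ 2) * Real.exp (q + b * ‖x‖ ^ 2) by
      rw [← Real.exp_add]; ring_nf]
    exact mul_le_mul_of_nonneg_left (Real.add_one_le_exp _) (Real.exp_pos _).le
  change _ * ENNReal.ofReal (Real.exp (F θ₀)) ≤ ∫⁻ θ, ENNReal.ofReal (Real.exp (F θ))
  rw [← lintegral_add_left_eq_self _ θ₀, mul_comm, ← ENNReal.ofReal_mul (Real.exp_pos _).le, ← hI,
    ← integral_const_mul]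
  exact (ofReal_integral_le_lintegral_ofReal (iG.const_mul _)).trans
    (lintegral_mono fun x => ENNReal.ofReal_le_ofReal (hle x))

end


/-! ### Lower bounds for estimation in the whitened Gaussian linear model -/

/-- The features `φ` have second moment matrix equal to the identity. -/
def IsIsotropic (PX : Measure α) (φ : α → EuclideanSpace ℝ (Fin d)) : Prop :=
  Measurable φ ∧ ∀ θ, Integrable (fun x => (inner ℝ θ (φ x)) ^ 2) PX ∧
    ∫ x, (inner ℝ θ (φ x)) ^ 2 ∂PX = ‖θ‖ ^ 2

/-- With probability at least `1 - δ`, the estimator `est` is at distance less than `r` from the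
true parameter, whatever the latter. -/
def IsAccurate (n : ℕ) (PX : Measure α) (v : ℝ≥0) (φ : α → EuclideanSpace ℝ (Fin d)) (δ r : ℝ)
    (est : (Fin n → α × ℝ) → EuclideanSpace ℝ (Fin d)) : Prop :=
  ∀ θ, ENNReal.ofReal (1 - δ) ≤
    Measure.pi (fun _ : Fin n => shiftedLaw PX v φ θ) {D | θ ∈ Metric.ball (est D) r}

lemma measurableSet_mem_ball {est : (Fin n → α × ℝ) → EuclideanSpace ℝ (Fin d)}
    (hest : Measurable est) (θ : EuclideanSpace ℝ (Fin d)) (r : ℝ) :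
    MeasurableSet {D | θ ∈ Metric.ball (est D) r} := by
  simp only [Metric.mem_ball]
  exact measurableSet_lt (by fun_prop) measurable_const

/-! ### Two-point lower bound -/

section TwoPoint

variable {PX : Measure α} [IsProbabilityMeasure PX] {v : ℝ≥0}
  {φ : α → EuclideanSpace ℝ (Fin d)}

lemma integrable_logLik (hφ : IsIsotropic PX φ) (θ : EuclideanSpace ℝ (Fin d)) :
    Integrable (fun D : Fin n → α × ℝ => logLik v φ D θ)
        (Measure.pi fun _ => PX.prod (gaussianReal 0 v)) ∧
      ∫ D : Fin n → α × ℝ, logLik v φ D θ ∂(Measure.pi fun _ => PX.prod (gaussianReal 0 v))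
        = -(n * ‖θ‖ ^ 2 / (2 * v)) := by
  obtain ⟨hm, h2⟩ := hφ
  obtain ⟨hi, he⟩ := h2 θ
  have hm' : Measurable fun x => inner ℝ θ (φ x) := by fun_prop
  have hi1 : Integrable (fun x => inner ℝ θ (φ x)) PX :=
    ((memLp_two_iff_integrable_sq hm'.aestronglyMeasurable).2 hi).integrable one_le_two
  have hη : Integrable (fun y : ℝ => y) (gaussianReal 0 v) :=
    (memLp_id_gaussianReal 1).integrable le_rfl
  have j1 : Integrable (fun z : α × ℝ => z.2 * inner ℝ θ (φ z.1))
      (PX.prod (gaussianReal 0 v)) := by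
    simpa only [mul_comm] using hi1.mul_prod hη
  have j2 : Integrable (fun z : α × ℝ => (inner ℝ θ (φ z.1)) ^ 2 / 2)
      (PX.prod (gaussianReal 0 v)) := (hi.comp_fst _).div_const 2
  have j : Integrable (fun z : α × ℝ =>
      (z.2 * inner ℝ θ (φ z.1) - (inner ℝ θ (φ z.1)) ^ 2 / 2) / v)
      (PX.prod (gaussianReal 0 v)) := (j1.sub j2).div_const _
  have e1 : ∫ z : α × ℝ, z.2 * inner ℝ θ (φ z.1) ∂(PX.prod (gaussianReal 0 v)) = 0 := by
    simp_rw [mul_comm _ (inner ℝ θ (φ _))]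
    rw [integral_prod_mul (fun x => inner ℝ θ (φ x)) (fun y : ℝ => y), integral_id_gaussianReal,
      mul_zero]
  have e2 : ∫ z : α × ℝ, (inner ℝ θ (φ z.1)) ^ 2 / 2 ∂(PX.prod (gaussianReal 0 v))
      = ‖θ‖ ^ 2 / 2 := by
    rw [integral_div, ← he]
    simpa using integral_prod_mul (μ := PX) (ν := gaussianReal 0 v)
      (fun x => (inner ℝ θ (φ x)) ^ 2) (fun _ : ℝ => (1 : ℝ))
  have ji : ∀ i : Fin n, Integrable (fun D : Fin n → α × ℝ =>
      ((D i).2 * inner ℝ θ (φ (D i).1) - (inner ℝ θ (φ (D i).1)) ^ 2 / 2) / v)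
      (Measure.pi fun _ => PX.prod (gaussianReal 0 v)) := fun i =>
    integrable_comp_eval (μ := fun _ : Fin n => PX.prod (gaussianReal 0 v)) (i := i) j
  refine ⟨integrable_finsetSum _ fun i _ => ji i, ?_⟩
  unfold logLik
  rw [integral_finsetSum _ fun i _ => ji i]
  rw [Finset.sum_congr rfl fun i _ => integral_comp_eval
      (μ := fun _ : Fin n => PX.prod (gaussianReal 0 v)) (i := i) j.aestronglyMeasurable,
    integral_div, integral_sub j1 j2, e1, e2]
  simp only [Finset.sum_const, Finset.card_univ, Fintype.card_fin, nsmul_eq_mul]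
  ring

/-- Le Cam's two-point bound, through the Hellinger affinity. -/
lemma exp_neg_le_two_mul_sqrt (hφ : IsIsotropic PX φ) (hv : v ≠ 0) {δ : ℝ} (hδ : 0 < δ)
    (θ : EuclideanSpace ℝ (Fin d)) {A : Set (Fin n → α × ℝ)} (hA : MeasurableSet A)
    (h0 : Measure.pi (fun _ : Fin n => shiftedLaw PX v φ 0) Aᶜ ≤ ENNReal.ofReal δ)
    (h1 : Measure.pi (fun _ : Fin n => shiftedLaw PX v φ θ) A ≤ ENNReal.ofReal δ) :
    Real.exp (-(n * ‖θ‖ ^ 2 / (4 * v))) ≤ 2 * √δ := by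
  have hm := hφ.1
  have := isProbabilityMeasure_shiftedLaw PX v hm θ
  set Q := Measure.pi fun _ : Fin n => PX.prod (gaussianReal 0 v) with hQ
  have hlm : Measurable fun D : Fin n → α × ℝ => logLik v φ D θ :=
    (measurable_logLik hm).comp (measurable_id.prodMk measurable_const)
  have hQ0 : Measure.pi (fun _ : Fin n => shiftedLaw PX v φ 0) = Q := by
    rw [pi_shiftedLaw_eq_withDensity PX hv hm]
    simp [logLik, hQ]
  have hPθ := pi_shiftedLaw_eq_withDensity (n := n) PX hv hm θ
  have hPA : ∀ B, MeasurableSet B → ∫⁻ D in B, ENNReal.ofReal (Real.exp (logLik v φ D θ)) ∂Q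
      = Measure.pi (fun _ : Fin n => shiftedLaw PX v φ θ) B := fun B hB => by
    rw [hPθ, withDensity_apply _ hB]
  obtain ⟨hint, hval⟩ := integrable_logLik (n := n) (v := v) hφ θ
  set a := -(n * ‖θ‖ ^ 2 / (4 * v)) with ha
  set ε := √δ with hε
  have hε0 : 0 < ε := Real.sqrt_pos.2 hδ
  have hεsq : ε * ε = δ := Real.mul_self_sqrt hδ.le
  -- Jensen's inequality for the affinity: a is the mean of half the log-likelihood ratio, and exp
  -- is bounded below by its tangent at a.
  have hlow : ENNReal.ofReal (Real.exp a)
      ≤ ∫⁻ D, ENNReal.ofReal (Real.exp (logLik v φ D θ / 2)) ∂Q := by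
    have hi : Integrable (fun D => Real.exp a * (logLik v φ D θ / 2 + (1 - a))) Q :=
      ((hint.div_const 2).add (integrable_const _)).const_mul _
    have he : ∫ D, Real.exp a * (logLik v φ D θ / 2 + (1 - a)) ∂Q = Real.exp a := by
      rw [integral_const_mul, integral_add (hint.div_const 2) (integrable_const _), integral_div,
        hval, integral_const]
      simp only [probReal_univ, one_smul]
      rw [show -(n * ‖θ‖ ^ 2 / (2 * v)) / 2 = a by rw [ha]; ring]
      ring
    rw [← he]
    refine (ofReal_integral_le_lintegral_ofReal hi).trans
      (lintegral_mono fun D => ENNReal.ofReal_le_ofReal ?_)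
    have h := Real.add_one_le_exp (logLik v φ D θ / 2 - a)
    calc _ ≤ Real.exp a * Real.exp (logLik v φ D θ / 2 - a) := by
          gcongr; linarith
      _ = _ := by rw [← Real.exp_add]; ring_nf
  -- Cauchy–Schwarz in its weighted form y ≤ t/2 + y²/(2t), with y the square root of the likelihood
  -- ratio.
  have hpt : ∀ t : ℝ, 0 < t → ∀ B, MeasurableSet B →
      ∫⁻ D in B, ENNReal.ofReal (Real.exp (logLik v φ D θ / 2)) ∂Q
        ≤ ENNReal.ofReal (t / 2) * Q B + ENNReal.ofReal (1 / (2 * t))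
          * Measure.pi (fun _ : Fin n => shiftedLaw PX v φ θ) B := fun t ht B hB => by
    rw [← hPA B hB, ← setLIntegral_const, ← lintegral_const_mul _ (by fun_prop),
      ← lintegral_add_left (by fun_prop)]
    refine lintegral_mono fun D => ?_
    rw [← ENNReal.ofReal_mul (by positivity), ← ENNReal.ofReal_add (by positivity) (by positivity)]
    refine ENNReal.ofReal_le_ofReal ?_
    set y := Real.exp (logLik v φ D θ / 2)
    have hy : Real.exp (logLik v φ D θ) = y * y := by rw [← Real.exp_add]; ring_nf
    rw [hy, show t / 2 + 1 / (2 * t) * (y * y) = y + (t - y) ^ 2 / (2 * t) by field_simp; ring]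
    exact le_add_of_nonneg_right (by positivity)
  have hup : ∫⁻ D, ENNReal.ofReal (Real.exp (logLik v φ D θ / 2)) ∂Q ≤ ENNReal.ofReal (2 * ε) := by
    rw [← lintegral_add_compl _ hA]
    calc _ ≤ (ENNReal.ofReal (ε / 2) * 1 + ENNReal.ofReal (1 / (2 * ε)) * ENNReal.ofReal δ)
          + (ENNReal.ofReal (ε⁻¹ / 2) * ENNReal.ofReal δ + ENNReal.ofReal (1 / (2 * ε⁻¹)) * 1) := by
          -- On A the measure at θ is small and on its complement the measure at 0 is; the weights ε
          -- and ε⁻¹ make each contribution equal to ε = √δ.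
          refine add_le_add ((hpt ε hε0 A hA).trans ?_) ((hpt ε⁻¹ (by positivity) Aᶜ hA.compl).trans ?_)
          · gcongr; exact prob_le_one
          · rw [hQ0] at h0
            gcongr; exact prob_le_one
      _ = ENNReal.ofReal (2 * ε) := by
          rw [mul_one, mul_one, ← ENNReal.ofReal_mul (by positivity),
            ← ENNReal.ofReal_mul (by positivity), ← ENNReal.ofReal_add (by positivity) (by positivity),
            ← ENNReal.ofReal_add (by positivity) (by positivity),
            ← ENNReal.ofReal_add (by positivity) (by positivity), ← hεsq]
          congr 1
          field_simp
          ring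
  exact (ENNReal.ofReal_le_ofReal_iff (by positivity)).1 (hlow.trans hup)

/-- Le Cam's bound applied to two parameters at distance 2r: since the balls are open, no estimate
is within r of both. -/
lemma IsAccurate.exp_neg_le (hφ : IsIsotropic PX φ) (hd : 0 < d) (hv : v ≠ 0) {δ r : ℝ}
    (hδ : 0 < δ) (hr : 0 ≤ r) {est : (Fin n → α × ℝ) → EuclideanSpace ℝ (Fin d)}
    (hest : Measurable est) (h : IsAccurate n PX v φ δ r est) :
    Real.exp (-(n * r ^ 2 / v)) ≤ 2 * √δ := by
  have hcompl : ∀ θ, Measure.pi (fun _ : Fin n => shiftedLaw PX v φ θ)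
      {D | θ ∈ Metric.ball (est D) r}ᶜ ≤ ENNReal.ofReal δ := fun θ => by
    have := isProbabilityMeasure_shiftedLaw PX v hφ.1 θ
    rw [prob_compl_eq_one_sub (measurableSet_mem_ball hest θ r)]
    refine tsub_le_iff_left.2 ?_
    refine le_trans ?_ (add_le_add_left (h θ) _)
    rw [← ENNReal.ofReal_one]
    refine le_trans (ENNReal.ofReal_le_ofReal (by linarith)) ENNReal.ofReal_add_le
  set θ : EuclideanSpace ℝ (Fin d) := EuclideanSpace.single ⟨0, hd⟩ (2 * r) with hθ
  have hnorm : ‖θ‖ = 2 * r := by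
    rw [hθ, PiLp.norm_single, Real.norm_of_nonneg (by positivity)]
  have key := exp_neg_le_two_mul_sqrt hφ hv hδ θ (measurableSet_mem_ball hest 0 r) (hcompl 0)
    ((measure_mono fun D hD hD' => ?_).trans (hcompl θ))
  · rwa [hnorm, show n * (2 * r) ^ 2 / (4 * (v : ℝ)) = n * r ^ 2 / v by field_simp; ring] at key
  · simp only [Set.mem_ofPred_eq, Metric.mem_ball] at hD hD'
    have := dist_triangle_right θ 0 (est D)
    rw [dist_zero_right, hnorm] at this
    linarith

end TwoPoint

/-! ### Bayesian lower bound -/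

section Bayes

variable {PX : Measure α} {v : ℝ≥0}
  {φ : α → EuclideanSpace ℝ (Fin d)}

lemma IsIsotropic.lintegral_sq_norm (hφ : IsIsotropic PX φ) :
    ∫⁻ x, ENNReal.ofReal (‖φ x‖ ^ 2) ∂PX = ENNReal.ofReal d := by
  have h : ∀ x, ‖φ x‖ ^ 2
      = ∑ i, (inner ℝ (EuclideanSpace.basisFun (Fin d) ℝ i) (φ x)) ^ 2 := fun x =>
    (OrthonormalBasis.sum_sq_inner_right _ _).symm
  have hi : Integrable (fun x => ‖φ x‖ ^ 2) PX := by
    simp_rw [h]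
    exact integrable_finsetSum _ fun i _ => (hφ.2 _).1
  rw [← ofReal_integral_eq_lintegral_ofReal hi (Filter.Eventually.of_forall fun x => by positivity)]
  congr 1
  simp_rw [h]
  rw [integral_finsetSum _ fun i _ => (hφ.2 _).1, Finset.sum_congr rfl fun i _ => (hφ.2 _).2]
  simp

/-- Normalised trace of the posterior precision under the prior `𝒩(0, 1 / l)`. -/
def precision (v : ℝ≥0) (φ : α → EuclideanSpace ℝ (Fin d)) (l : ℝ) (D : Fin n → α × ℝ) : ℝ :=
  l + ∑ i, ‖φ (D i).1‖ ^ 2 / (d * v)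

/-- The precision depends on the features alone, whose law does not involve θ, and the mean of ‖φ‖²
is d. -/
lemma lintegral_precision [IsProbabilityMeasure PX] (hφ : IsIsotropic PX φ) (hd : 0 < d) {a β l : ℝ}
    (ha : 0 ≤ a) (hβ : 0 ≤ β) (hl : 0 ≤ l) (θ : EuclideanSpace ℝ (Fin d)) :
    ∫⁻ D, ENNReal.ofReal (a + β * precision v φ l D)
        ∂(Measure.pi fun _ : Fin n => shiftedLaw PX v φ θ)
      = ENNReal.ofReal (a + β * (l + n / v)) := by
  have hm := hφ.1
  have := isProbabilityMeasure_shiftedLaw PX v hm θ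
  have h1 : ∀ D : Fin n → α × ℝ, ENNReal.ofReal (a + β * precision v φ l D)
      = ENNReal.ofReal (a + β * l) + ∑ i, ENNReal.ofReal (β / (d * v))
        * ENNReal.ofReal (‖φ (D i).1‖ ^ 2) := fun D => by
    simp_rw [← ENNReal.ofReal_mul (show 0 ≤ β / (d * v) by positivity)]
    rw [← ENNReal.ofReal_sum_of_nonneg fun i _ => by positivity,
      ← ENNReal.ofReal_add (by positivity) (Finset.sum_nonneg fun i _ => by positivity)]
    congr 1
    rw [precision, mul_add, Finset.mul_sum, add_assoc]
    congr 2
    exact Finset.sum_congr rfl fun i _ => by ring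
  have h2 : ∀ i : Fin n, ∫⁻ D, ENNReal.ofReal (‖φ (D i).1‖ ^ 2)
      ∂(Measure.pi fun _ : Fin n => shiftedLaw PX v φ θ) = ENNReal.ofReal d := fun i => by
    rw [(measurePreserving_eval (fun _ : Fin n => shiftedLaw PX v φ θ) i).lintegral_comp
      (f := fun z : α × ℝ => ENNReal.ofReal (‖φ z.1‖ ^ 2)) (by fun_prop), shiftedLaw,
      lintegral_map (by fun_prop) (by fun_prop), lintegral_prod _ (by fun_prop)]
    simpa using hφ.lintegral_sq_norm
  simp_rw [h1]
  rw [lintegral_add_left measurable_const, lintegral_finsetSum _ fun i _ => by fun_prop,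
    Finset.sum_congr rfl fun i _ => lintegral_const_mul _ (by fun_prop),
    Finset.sum_congr rfl fun i _ => by rw [h2 i]]
  rw [lintegral_const, measure_univ, mul_one, Finset.sum_const, Finset.card_univ, Fintype.card_fin,
    ← ENNReal.ofReal_mul (by positivity), nsmul_eq_mul, ← ENNReal.ofReal_natCast,
    ← ENNReal.ofReal_mul (by positivity), ← ENNReal.ofReal_add (by positivity) (by positivity)]
  congr 1
  have : (d : ℝ) ≠ 0 := by positivity
  field_simp
  ring

/-- The unnormalised posterior is the exponential of a quadratic, so its mass on a ball is at most
its supremum times the volume, and trivially at most its total mass. `hab` makes the resulting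
minimum affine in the precision, ready for averaging. -/
lemma setLIntegral_ball_le {α : Type*} {φ : α → EuclideanSpace ℝ (Fin d)} (hd : 0 < d)
    (hv : v ≠ 0) {a β l r : ℝ} (hl : 0 < l)
    (hab : ∀ s : ℝ, 0 < s →
      min 1 ((volume (Metric.ball (0 : EuclideanSpace ℝ (Fin d)) r)).toReal
        * (s / (2 * Real.pi)) ^ (d / 2 : ℝ)) ≤ a + β * s)
    (D : Fin n → α × ℝ) (w : EuclideanSpace ℝ (Fin d)) :
    ∫⁻ θ in Metric.ball w r, ENNReal.ofReal (Real.exp (logLik v φ D θ - l * ‖θ‖ ^ 2 / 2))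
      ≤ ENNReal.ofReal (a + β * precision v φ l D)
        * ∫⁻ θ, ENNReal.ofReal (Real.exp (logLik v φ D θ - l * ‖θ‖ ^ 2 / 2)) := by
  have hv' : (0 : ℝ) < v := by exact_mod_cast pos_iff_ne_zero.2 hv
  have hd' : (d : ℝ) ≠ 0 := by positivity
  set s := precision v φ l D with hs
  have hs0 : 0 < s := add_pos_of_pos_of_nonneg hl (Finset.sum_nonneg fun i _ => by positivity)
  set Z := ∫⁻ θ, ENNReal.ofReal (Real.exp (logLik v φ D θ - l * ‖θ‖ ^ 2 / 2)) with hZ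
  have hquad : ∀ θ, logLik v φ D θ - l * ‖θ‖ ^ 2 / 2
      = 0 + inner ℝ (∑ i, ((D i).2 / v) • φ (D i).1) θ - l * ‖θ‖ ^ 2 / 2
        - (∑ i, (inner ℝ ((√(v : ℝ))⁻¹ • φ (D i).1) θ) ^ 2) / 2 := fun θ => by
    simp only [logLik, inner_sum, real_inner_smul_right, Finset.sum_div, mul_pow, inv_pow,
      Real.sq_sqrt hv'.le, zero_add, real_inner_comm θ]
    rw [sub_right_comm, ← Finset.sum_sub_distrib]
    congr 1
    exact Finset.sum_congr rfl fun i _ => by field_simp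
  have hsup : ∀ θ₀, ENNReal.ofReal (Real.exp (logLik v φ D θ₀ - l * ‖θ₀‖ ^ 2 / 2))
      ≤ ENNReal.ofReal ((s / (2 * Real.pi)) ^ (d / 2 : ℝ)) * Z := fun θ₀ => by
    have h := exp_quadratic_mul_le_lintegral
      (V := EuclideanSpace ℝ (Fin d)) (fun i => (√(v : ℝ))⁻¹ • φ (D i).1) 0 l
      (∑ i, ((D i).2 / v) • φ (D i).1) hs0 (by
        simp only [finrank_euclideanSpace, Fintype.card_fin, norm_smul, mul_pow, norm_inv, inv_pow,
          Real.norm_eq_abs, sq_abs, Real.sq_sqrt hv'.le, hs, precision, mul_add, Finset.mul_sum]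
        congr 1
        exact Finset.sum_congr rfl fun i _ => by field_simp) (by simpa using hd) θ₀
    simp_rw [← hquad, finrank_euclideanSpace, Fintype.card_fin] at h
    rw [← hZ] at h
    refine le_trans (le_of_eq ?_) (mul_le_mul_right h _)
    rw [← mul_assoc, ← ENNReal.ofReal_mul (by positivity), ← Real.mul_rpow (by positivity)
      (by positivity), show s / (2 * Real.pi) * (2 * Real.pi / s) = 1 by
        field_simp, Real.one_rpow, ENNReal.ofReal_one, one_mul]
  set V := (volume (Metric.ball (0 : EuclideanSpace ℝ (Fin d)) r)).toReal
  have hVw : volume (Metric.ball w r) = ENNReal.ofReal V := by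
    rw [Measure.addHaar_ball_center, ENNReal.ofReal_toReal measure_ball_lt_top.ne]
  have hmin : ∫⁻ θ in Metric.ball w r,
        ENNReal.ofReal (Real.exp (logLik v φ D θ - l * ‖θ‖ ^ 2 / 2))
      ≤ ENNReal.ofReal (min 1 (V * (s / (2 * Real.pi)) ^ (d / 2 : ℝ))) * Z := by
    rcases min_cases 1 (V * (s / (2 * Real.pi)) ^ (d / 2 : ℝ)) with h | h
    · rw [h.1, ENNReal.ofReal_one, one_mul]
      exact setLIntegral_le_lintegral _ _
    · rw [h.1, ENNReal.ofReal_mul ENNReal.toReal_nonneg, ← hVw, mul_assoc, mul_comm,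
        ← setLIntegral_const]
      exact lintegral_mono fun θ => hsup θ
  exact hmin.trans (by gcongr; exact hab s hs0)

lemma lintegral_gaussian_prior {l : ℝ} (hl : 0 < l) :
    ENNReal.ofReal ((l / (2 * Real.pi)) ^ (d / 2 : ℝ))
      * ∫⁻ θ : EuclideanSpace ℝ (Fin d), ENNReal.ofReal (Real.exp (-(l * ‖θ‖ ^ 2 / 2))) = 1 := by
  have hl2 : 0 < l / 2 := half_pos hl
  have h := GaussianFourier.integral_rexp_neg_mul_sq_norm (V := EuclideanSpace ℝ (Fin d)) hl2
  have hi := integrable_exp_neg_mul_sq_norm (V := EuclideanSpace ℝ (Fin d)) hl2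
  simp_rw [show ∀ θ : EuclideanSpace ℝ (Fin d), -(l * ‖θ‖ ^ 2 / 2) = -(l / 2) * ‖θ‖ ^ 2 from
    fun θ => by ring]
  rw [← ofReal_integral_eq_lintegral_ofReal hi (Filter.Eventually.of_forall fun _ => by positivity),
    h, ← ENNReal.ofReal_mul (by positivity), finrank_euclideanSpace, Fintype.card_fin,
    ← Real.mul_rpow (by positivity) (by positivity),
    show l / (2 * Real.pi) * (Real.pi / (l / 2)) = 1 by field_simp, Real.one_rpow,
    ENNReal.ofReal_one]

/-- Averaging over a prior with density `p`: if the posterior mass of the section of `S` at `D` is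
at most `w D`, then the sections of `S` have probability at most the mean of `w` on average. -/
lemma mul_lintegral_prior_le {Ω Θ : Type*} [MeasurableSpace Ω] [MeasurableSpace Θ] {Q : Measure Ω}
    {μ : Measure Θ} [SFinite Q] [SFinite μ] {p : Θ → ℝ≥0∞} {L : Ω → Θ → ℝ≥0∞} {S : Set (Ω × Θ)}
    {w : Ω → ℝ≥0∞} {b c : ℝ≥0∞} (hp : Measurable p) (hL : Measurable (Function.uncurry L))
    (hS : MeasurableSet S) (hw : Measurable w)
    (hb : ∀ θ, b ≤ ∫⁻ D in {D | (D, θ) ∈ S}, L D θ ∂Q)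
    (hpost : ∀ D, ∫⁻ θ in {θ | (D, θ) ∈ S}, p θ * L D θ ∂μ ≤ w D * ∫⁻ θ, p θ * L D θ ∂μ)
    (hc : ∀ θ, ∫⁻ D, w D * L D θ ∂Q = c) :
    b * ∫⁻ θ, p θ ∂μ ≤ c * ∫⁻ θ, p θ ∂μ := by
  have hpL : Measurable fun z : Ω × Θ => p z.2 * L z.1 z.2 := (hp.comp measurable_snd).mul hL
  have hSθ : ∀ θ, MeasurableSet {D | (D, θ) ∈ S} := fun θ =>
    (measurable_id.prodMk measurable_const) hS
  have hSD : ∀ D, MeasurableSet {θ | (D, θ) ∈ S} := fun D =>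
    (measurable_const.prodMk measurable_id) hS
  have hLθ : ∀ θ, Measurable fun D => L D θ := fun θ =>
    hL.comp (measurable_id.prodMk measurable_const)
  have hpLD : ∀ D, Measurable fun θ => p θ * L D θ := fun D =>
    hpL.comp (measurable_const.prodMk measurable_id)
  calc b * ∫⁻ θ, p θ ∂μ = ∫⁻ θ, b * p θ ∂μ := (lintegral_const_mul _ hp).symm
    _ ≤ ∫⁻ θ, ∫⁻ D, S.indicator (fun z => p z.2 * L z.1 z.2) (D, θ) ∂Q ∂μ := by
        refine lintegral_mono fun θ => ?_
        calc b * p θ ≤ (∫⁻ D in {D | (D, θ) ∈ S}, L D θ ∂Q) * p θ := by gcongr; exact hb θ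
          _ = ∫⁻ D in {D | (D, θ) ∈ S}, p θ * L D θ ∂Q := by
              rw [mul_comm, lintegral_const_mul _ (hLθ θ)]
          _ = ∫⁻ D, S.indicator (fun z => p z.2 * L z.1 z.2) (D, θ) ∂Q := by
              rw [← lintegral_indicator (hSθ θ)]
              rfl
    _ = ∫⁻ D, ∫⁻ θ, S.indicator (fun z => p z.2 * L z.1 z.2) (D, θ) ∂μ ∂Q :=
        (lintegral_lintegral_swap (f := fun D θ => S.indicator (fun z => p z.2 * L z.1 z.2) (D, θ))
          (hpL.indicator hS).aemeasurable).symm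
    _ ≤ ∫⁻ D, ∫⁻ θ, w D * (p θ * L D θ) ∂μ ∂Q := by
        refine lintegral_mono fun D => ?_
        calc ∫⁻ θ, S.indicator (fun z => p z.2 * L z.1 z.2) (D, θ) ∂μ
            = ∫⁻ θ in {θ | (D, θ) ∈ S}, p θ * L D θ ∂μ := by
              rw [← lintegral_indicator (hSD D)]
              rfl
          _ ≤ w D * ∫⁻ θ, p θ * L D θ ∂μ := hpost D
          _ = ∫⁻ θ, w D * (p θ * L D θ) ∂μ := (lintegral_const_mul _ (hpLD D)).symm
    _ = ∫⁻ θ, ∫⁻ D, w D * (p θ * L D θ) ∂Q ∂μ :=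
        lintegral_lintegral_swap (f := fun D θ => w D * (p θ * L D θ))
          ((hw.comp measurable_fst).mul hpL).aemeasurable
    _ = ∫⁻ θ, c * p θ ∂μ := by
        refine lintegral_congr fun θ => ?_
        rw [← hc θ, mul_comm, ← lintegral_const_mul (p θ)
          (f := fun D => w D * L D θ) (hw.mul (hLθ θ))]
        exact lintegral_congr fun D => by ring
    _ = c * ∫⁻ θ, p θ ∂μ := lintegral_const_mul _ hp

/-- Bayesian lower bound with prior `𝒩(0, 1 / l)`: a bound on the posterior probability of balls
of radius `r` in terms of the precision bounds the accuracy of any estimator. -/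
lemma IsAccurate.one_sub_le_of_prior [IsProbabilityMeasure PX] (hφ : IsIsotropic PX φ)
    (hd : 0 < d) (hv : v ≠ 0)
    {δ r a β l : ℝ} (ha : 0 ≤ a) (hβ : 0 ≤ β) (hl : 0 < l)
    (hab : ∀ s : ℝ, 0 < s →
      min 1 ((volume (Metric.ball (0 : EuclideanSpace ℝ (Fin d)) r)).toReal
        * (s / (2 * Real.pi)) ^ (d / 2 : ℝ)) ≤ a + β * s)
    {est : (Fin n → α × ℝ) → EuclideanSpace ℝ (Fin d)}
    (hest : Measurable est) (h : IsAccurate n PX v φ δ r est) :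
    1 - δ ≤ a + β * (l + n / v) := by
  have hm := hφ.1
  have hlm := measurable_logLik (n := n) (v := v) hm
  have hlm' : ∀ θ, Measurable fun D : Fin n → α × ℝ => logLik v φ D θ := fun θ =>
    hlm.comp (measurable_id.prodMk measurable_const)
  have hwm : Measurable fun D : Fin n → α × ℝ => ENNReal.ofReal (a + β * precision v φ l D) := by
    unfold precision; fun_prop
  have hSm : MeasurableSet {z : (Fin n → α × ℝ) × EuclideanSpace ℝ (Fin d) |
      z.2 ∈ Metric.ball (est z.1) r} := by
    simp only [Metric.mem_ball]
    exact measurableSet_lt (by fun_prop) measurable_const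
  have hpL : ∀ (D : Fin n → α × ℝ) θ,
      ENNReal.ofReal (Real.exp (logLik v φ D θ - l * ‖θ‖ ^ 2 / 2))
        = ENNReal.ofReal (Real.exp (-(l * ‖θ‖ ^ 2 / 2)))
          * ENNReal.ofReal (Real.exp (logLik v φ D θ)) := fun D θ => by
    rw [← ENNReal.ofReal_mul (by positivity), ← Real.exp_add]; congr 2; ring
  have key := mul_lintegral_prior_le (μ := volume)
    (Q := Measure.pi fun _ : Fin n => PX.prod (gaussianReal 0 v))
    (p := fun θ : EuclideanSpace ℝ (Fin d) => ENNReal.ofReal (Real.exp (-(l * ‖θ‖ ^ 2 / 2))))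
    (L := fun D θ => ENNReal.ofReal (Real.exp (logLik v φ D θ)))
    (b := ENNReal.ofReal (1 - δ)) (c := ENNReal.ofReal (a + β * (l + n / v)))
    (by fun_prop) (ENNReal.measurable_ofReal.comp (Real.measurable_exp.comp hlm)) hSm hwm
    (fun θ => by
      refine (h θ).trans ?_
      rw [pi_shiftedLaw_eq_withDensity PX hv hm,
        withDensity_apply _ (measurableSet_mem_ball hest θ r)]
      exact le_rfl)
    (fun D => by
      have h2 := setLIntegral_ball_le (φ := φ) hd hv hl hab D (est D)
      simp_rw [hpL] at h2
      exact h2)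
    (fun θ => by
      rw [← lintegral_precision (n := n) (v := v) hφ hd ha hβ hl.le θ,
        pi_shiftedLaw_eq_withDensity PX hv hm, lintegral_withDensity_eq_lintegral_mul _
          (f := fun D : Fin n → α × ℝ => ENNReal.ofReal (Real.exp (logLik v φ D θ)))
          (ENNReal.measurable_ofReal.comp (Real.measurable_exp.comp (hlm' θ))) hwm]
      exact lintegral_congr fun D => mul_comm _ _)
  have hfin := mul_le_mul_right key (ENNReal.ofReal ((l / (2 * Real.pi)) ^ (d / 2 : ℝ)))
  rw [mul_left_comm, mul_left_comm _ (ENNReal.ofReal (a + β * (l + n / v))),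
    lintegral_gaussian_prior hl, mul_one, mul_one] at hfin
  exact (ENNReal.ofReal_le_ofReal_iff (by positivity)).1 hfin

/-- Flat-prior limit l → 0. The prior stays proper until here so that its finite mass can be
cancelled. -/
lemma IsAccurate.one_sub_le [IsProbabilityMeasure PX] (hφ : IsIsotropic PX φ)
    (hd : 0 < d) (hv : v ≠ 0)
    {δ r a β : ℝ} (ha : 0 ≤ a) (hβ : 0 ≤ β)
    (hab : ∀ s : ℝ, 0 < s →
      min 1 ((volume (Metric.ball (0 : EuclideanSpace ℝ (Fin d)) r)).toReal
        * (s / (2 * Real.pi)) ^ (d / 2 : ℝ)) ≤ a + β * s)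
    {est : (Fin n → α × ℝ) → EuclideanSpace ℝ (Fin d)}
    (hest : Measurable est) (h : IsAccurate n PX v φ δ r est) :
    1 - δ ≤ a + β * (n / v) := by
  refine le_of_forall_pos_le_add fun ε hε => ?_
  have h1 := h.one_sub_le_of_prior hφ hd hv ha hβ (l := ε / (β + 1)) (by positivity) hab hest
  have h2 : β * (ε / (β + 1)) ≤ ε := by
    rw [mul_div_assoc', div_le_iff₀ (by positivity)]
    nlinarith
  linarith

end Bayes


/-! ### Volumes of balls and the numerical contradiction -/

/-- Chernoff-type bound: compare the indicator of the ball with a Gaussian. The exponent d/(2t) is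
the optimal one. -/
lemma volume_ball_toReal_le {d : ℕ} (hd : 0 < d) {t : ℝ} (ht : 0 < t) :
    (volume (Metric.ball (0 : EuclideanSpace ℝ (Fin d)) (√t))).toReal
      ≤ (2 * Real.pi * Real.exp 1 * t / d) ^ (d / 2 : ℝ) := by
  have hb : 0 < d / (2 * t) := by positivity
  have hi := integrable_exp_neg_mul_sq_norm (V := EuclideanSpace ℝ (Fin d)) hb
  have h := GaussianFourier.integral_rexp_neg_mul_sq_norm (V := EuclideanSpace ℝ (Fin d)) hb
  rw [finrank_euclideanSpace, Fintype.card_fin] at h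
  set B := Metric.ball (0 : EuclideanSpace ℝ (Fin d)) (√t)
  have h1 : Real.exp (-(d / 2 : ℝ)) * (volume B).toReal
      ≤ (Real.pi / (d / (2 * t))) ^ (d / 2 : ℝ) := by
    rw [← h]
    calc _ = ∫ _ in B, Real.exp (-(d / 2 : ℝ)) := by
          rw [setIntegral_const, smul_eq_mul, mul_comm]; rfl
      _ ≤ ∫ x in B, Real.exp (-(d / (2 * t)) * ‖x‖ ^ 2) := by
          refine setIntegral_mono_on (integrableOn_const measure_ball_lt_top.ne)
            hi.integrableOn measurableSet_ball fun x hx => Real.exp_le_exp.2 ?_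
          have hx' : ‖x‖ ^ 2 ≤ t := by
            rw [← Real.sq_sqrt ht.le]
            have := mem_ball_zero_iff.1 hx
            gcongr
          calc -(d / 2 : ℝ) = -(d / (2 * t)) * t := by field_simp
            _ ≤ -(d / (2 * t)) * ‖x‖ ^ 2 := by
              rw [neg_mul, neg_mul]; exact neg_le_neg (by gcongr)
      _ ≤ _ := setIntegral_le_integral hi (Filter.Eventually.of_forall fun _ => by positivity)
  have h2 : (volume B).toReal ≤ Real.exp (d / 2 : ℝ) * (Real.pi / (d / (2 * t))) ^ (d / 2 : ℝ) := by
    rw [Real.exp_neg] at h1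
    rwa [inv_mul_le_iff₀ (Real.exp_pos _)] at h1
  refine h2.trans (le_of_eq ?_)
  rw [← Real.exp_one_rpow, ← Real.mul_rpow (by positivity) (by positivity)]
  congr 1
  field_simp

lemma volume_ball_fin_one_toReal {r : ℝ} (hr : 0 ≤ r) :
    (volume (Metric.ball (0 : EuclideanSpace ℝ (Fin 1)) r)).toReal = 2 * r := by
  rw [EuclideanSpace.volume_ball]
  simp only [Fintype.card_fin, pow_one, Nat.cast_one]
  rw [Real.Gamma_add_one (by norm_num), Real.Gamma_one_half_eq, ENNReal.toReal_mul,
    ENNReal.toReal_ofReal hr, ENNReal.toReal_ofReal (by positivity)]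
  have := Real.sqrt_pos.2 Real.pi_pos
  field_simp

/-- The volume bound gives z^(d/2) with z = e t s / d, and min(1, z^(d/2)) ≤ z because d/2 ≥ 1. In
dimension one the exponent is 1/2, and y ≤ 1/4 + y² serves instead. -/
lemma min_one_volume_ball_mul_le {d : ℕ} (hd : 2 ≤ d) {t s : ℝ} (ht : 0 < t) (hs : 0 < s) :
    min 1 ((volume (Metric.ball (0 : EuclideanSpace ℝ (Fin d)) (√t))).toReal
      * (s / (2 * Real.pi)) ^ (d / 2 : ℝ)) ≤ 0 + Real.exp 1 * t / d * s := by
  have hd0 : (0 : ℝ) < d := by positivity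
  have hd2 : (2 : ℝ) ≤ d := by exact_mod_cast hd
  set z := Real.exp 1 * t / d * s with hz
  have hz0 : 0 < z := by positivity
  have h : (volume (Metric.ball (0 : EuclideanSpace ℝ (Fin d)) (√t))).toReal
      * (s / (2 * Real.pi)) ^ (d / 2 : ℝ) ≤ z ^ (d / 2 : ℝ) := by
    refine (mul_le_mul_of_nonneg_right (volume_ball_toReal_le (by lia) ht)
      (by positivity)).trans (le_of_eq ?_)
    rw [← Real.mul_rpow (by positivity) (by positivity), hz]
    congr 1
    field_simp
  rw [zero_add]
  rcases le_total 1 z with h1 | h1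
  · exact (min_le_left _ _).trans h1
  · refine (min_le_right _ _).trans (h.trans ?_)
    calc z ^ (d / 2 : ℝ) ≤ z ^ (1 : ℝ) :=
          Real.rpow_le_rpow_of_exponent_ge hz0 h1 (by linarith)
      _ = z := Real.rpow_one z

lemma min_one_volume_ball_fin_one_mul_le {t s : ℝ} (ht : 0 < t) (hs : 0 < s) :
    min 1 ((volume (Metric.ball (0 : EuclideanSpace ℝ (Fin 1)) (√t))).toReal
      * (s / (2 * Real.pi)) ^ ((1 : ℕ) / 2 : ℝ)) ≤ 1 / 4 + 2 * t / Real.pi * s := by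
  refine (min_le_right _ _).trans ?_
  rw [volume_ball_fin_one_toReal (Real.sqrt_nonneg t), Nat.cast_one, ← Real.sqrt_eq_rpow]
  set y := 2 * √t * √(s / (2 * Real.pi)) with hy
  have h : y ^ 2 = 2 * t / Real.pi * s := by
    rw [hy, mul_pow, mul_pow, Real.sq_sqrt ht.le, Real.sq_sqrt (by positivity)]
    field_simp
  rw [← h]
  nlinarith [sq_nonneg (y - 1 / 2)]

/-- Tangent line of log at c. Taking c to be a power of 2 close to 1/δ leaves only log 2 to
estimate. -/
lemma log_one_div_le {δ c : ℝ} (hδ : 0 < δ) (hc : 0 < c) :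
    Real.log (1 / δ) ≤ Real.log c + 1 / (c * δ) - 1 := by
  have h1 : (1 : ℝ) / δ = c * (1 / (c * δ)) := by field_simp
  have h2 := Real.log_le_sub_one_of_pos (show 0 < 1 / (c * δ) by positivity)
  rw [h1, Real.log_mul hc.ne' (by positivity)]
  linarith

lemma one_quarter_add_lt {δ L : ℝ} (hδ : 0 < δ) (hδ' : δ < 1 / 2) (hL : L = Real.log (1 / δ))
    (h : 3 * L ≤ 1 + 8 * Real.log 2) : 1 / 4 + (1 + L) / (4 * Real.pi) < 1 - δ := by
  have hlog := Real.log_two_lt_d9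
  have hpi := Real.pi_gt_three
  have hL0 : 0 < L := hL ▸ Real.log_pos (by rw [lt_div_iff₀ hδ]; linarith)
  have h1 : (1 + L) / (4 * Real.pi) ≤ (1 + L) / 12 := by gcongr; linarith
  rcases lt_or_ge δ 0.4 with h2 | h2
  · linarith
  · have h3 := log_one_div_le hδ two_pos
    have h4 : 1 / (2 * δ) ≤ 1 / (2 * 0.4) := by gcongr
    rw [← hL] at h3
    have h5 : (1 : ℝ) / (2 * 0.4) = 5 / 4 := by norm_num
    linarith

lemma exp_one_mul_lt {d : ℕ} (hd : 2 ≤ d) {δ L : ℝ} (hδ : 0 < δ) (hδ' : δ < 1 / 2)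
    (hL : L = Real.log (1 / δ)) (h : 3 * L ≤ d + 8 * Real.log 2) :
    Real.exp 1 * (d + L) / (8 * d) < 1 - δ := by
  have hlog := Real.log_two_lt_d9
  have he := Real.exp_one_lt_d9
  have hd2 : (2 : ℝ) ≤ d := by exact_mod_cast hd
  have hL0 : 0 < L := hL ▸ Real.log_pos (by rw [lt_div_iff₀ hδ]; linarith)
  -- For small δ the bound q on L/d comes from `h`; for larger δ it comes from the tangents of log
  -- at 4 and at 2, divided by d ≥ 2. The thresholds 0.23 and 0.409 lie just below where the
  -- preceding estimate stops sufficing.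
  suffices H : ∃ q, L ≤ q * d ∧ 2.7182818286 * (1 + q) < 8 * (1 - δ) by
    obtain ⟨q, hq, hq'⟩ := H
    rw [div_lt_iff₀ (by positivity)]
    calc Real.exp 1 * (d + L) ≤ 2.7182818286 * (d + q * d) := by gcongr
      _ = 2.7182818286 * (1 + q) * d := by ring
      _ < 8 * (1 - δ) * d := by gcongr
      _ = _ := by ring
  rcases lt_or_ge δ 0.23 with h2 | h2
  · exact ⟨1.26, by linarith, by linarith⟩
  · have key : ∀ c ρ : ℝ, 0 < c → 0 < ρ → ρ ≤ δ → L ≤ Real.log c + 1 / (c * ρ) - 1 :=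
      fun c ρ hc hρ hρδ => by
        have h4 : 1 / (c * δ) ≤ 1 / (c * ρ) := by gcongr
        rw [hL]
        linarith [log_one_div_le hδ hc]
    rcases lt_or_ge δ 0.409 with h3 | h3
    · have h5 := key 4 0.23 (by norm_num) (by norm_num) h2
      rw [show (4 : ℝ) = 2 ^ 2 by norm_num, Real.log_pow] at h5
      norm_num at h5
      exact ⟨0.737, by linarith, by linarith⟩
    · have h5 := key 2 0.409 (by norm_num) (by norm_num) h3
      norm_num at h5
      exact ⟨0.458, by linarith, by linarith⟩

lemma not_isAccurate {d n : ℕ} {α : Type*} [MeasurableSpace α] {PX : Measure α}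
    [IsProbabilityMeasure PX] {v : ℝ≥0} {φ : α → EuclideanSpace ℝ (Fin d)}
    (hφ : IsIsotropic PX φ) (hd : 0 < d) (hn : 0 < n) (hv : v ≠ 0) {δ : ℝ} (hδ : 0 < δ)
    (hδ' : δ < 1 / 2) {est : (Fin n → α × ℝ) → EuclideanSpace ℝ (Fin d)} (hest : Measurable est) :
    ¬ IsAccurate n PX v φ δ (√(v * (d + Real.log (1 / δ)) / (8 * n))) est := by
  intro h
  set L := Real.log (1 / δ) with hL
  set t := v * (d + L) / (8 * n) with ht
  have hv' : (0 : ℝ) < v := by exact_mod_cast pos_iff_ne_zero.2 hv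
  have hn' : (0 : ℝ) < n := by exact_mod_cast hn
  have hd' : (0 : ℝ) < d := by exact_mod_cast hd
  have hL0 : 0 < L := hL ▸ Real.log_pos (by rw [lt_div_iff₀ hδ]; linarith)
  have ht0 : 0 < t := by positivity
  have h1 := h.exp_neg_le hφ hd hv hδ (Real.sqrt_nonneg _) hest
  -- Logarithm of the two-point bound: L/2 ≤ log 2 + (d + L)/8.
  have h2 : 3 * L ≤ d + 8 * Real.log 2 := by
    have h3 := Real.log_le_log (Real.exp_pos _) h1
    have hsq : 0 < √δ := Real.sqrt_pos.2 hδ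
    rw [Real.log_exp, Real.log_mul two_ne_zero hsq.ne', Real.log_sqrt hδ.le, Real.sq_sqrt ht0.le,
      show n * t / v = (d + L) / 8 by rw [ht]; field_simp] at h3
    rw [one_div, Real.log_inv] at hL
    linarith
  rcases Nat.lt_or_ge d 2 with hd1 | hd2
  · obtain rfl : d = 1 := by lia
    have h3 := h.one_sub_le hφ hd hv (a := 1 / 4) (β := 2 * t / Real.pi) (by norm_num)
      (by positivity) (fun s hs => min_one_volume_ball_fin_one_mul_le ht0 hs) hest
    rw [show 2 * t / Real.pi * (n / v) = (1 + L) / (4 * Real.pi) by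
      rw [ht]; push_cast; field_simp; ring] at h3
    exact absurd h3 (not_le.2 (one_quarter_add_lt hδ hδ' hL (by simpa using h2)))
  · have h3 := h.one_sub_le hφ hd hv (a := 0) (β := Real.exp 1 * t / d) le_rfl
      (by positivity) (fun s hs => min_one_volume_ball_mul_le hd2 ht0 hs) hest
    rw [show Real.exp 1 * t / d * (n / v) = Real.exp 1 * (d + L) / (8 * d) by
      rw [ht]; field_simp, zero_add] at h3
    exact absurd h3 (not_le.2 (exp_one_mul_lt hd2 hδ hδ' hL h2))


/-! ### Lower bound on the excess expected error -/

/-- Bernoulli's inequality with exponent p/2 ≥ 1 applied to ((a + y)/y)². Unlike the tangent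
inequality, it keeps a term in a², and the term linear in a is odd in y. -/
lemma abs_rpow_add_le_abs_add_rpow {p : ℝ} (hp : 2 < p) (y a : ℝ) :
    |y| ^ p + p / 2 * (|y| ^ (p - 2) * (2 * a * y + a ^ 2)) ≤ |a + y| ^ p := by
  rcases eq_or_ne y 0 with rfl | hy
  · rw [abs_zero, Real.zero_rpow (by linarith), Real.zero_rpow (by linarith)]
    simp only [zero_mul, mul_zero, add_zero]
    positivity
  · have hu : 0 < |y| := abs_pos.2 hy
    have hc : |a + y| ^ p = |y| ^ p * ((|a + y| / |y|) ^ 2) ^ (p / 2) := by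
      rw [← Real.rpow_natCast (|a + y| / |y|) 2, ← Real.rpow_mul (by positivity),
        show ((2 : ℕ) : ℝ) * (p / 2) = p by push_cast; ring,
        ← Real.mul_rpow (by positivity) (by positivity)]
      congr 1
      field_simp
    have hb := one_add_mul_self_le_rpow_one_add
      (show -1 ≤ (|a + y| / |y|) ^ 2 - 1 by linarith [sq_nonneg (|a + y| / |y|)])
      (show 1 ≤ p / 2 by linarith)
    rw [add_sub_cancel] at hb
    have hp2 : |y| ^ p = |y| ^ (p - 2) * |y| ^ 2 := by
      rw [← Real.rpow_natCast, ← Real.rpow_add hu]; congr 1; push_cast; ring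
    have hsq : |y| ^ 2 * ((|a + y| / |y|) ^ 2 - 1) = 2 * a * y + a ^ 2 := by
      rw [div_pow, mul_sub, mul_div_cancel₀ _ (by positivity), sq_abs, sq_abs]
      ring
    rw [hc]
    refine le_trans (le_of_eq ?_) (mul_le_mul_of_nonneg_left hb (by positivity))
    rw [← hsq, hp2]
    ring

lemma powerError_neg (p t : ℝ) : powerError p (-t) = powerError p t := by
  rw [powerError, powerError, abs_neg]

lemma powerError_nonneg {p : ℝ} (hp : 2 < p) (t : ℝ) : 0 ≤ powerError p t :=
  div_nonneg (by positivity) (mul_nonneg (by linarith) (by linarith))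

lemma measurable_powerError (p : ℝ) : Measurable (powerError p) := by
  unfold powerError; fun_prop

lemma powerError_add_le {p : ℝ} (hp : 2 < p) (y a : ℝ) :
    powerError p y + 1 / (2 * (p - 1)) * (|y| ^ (p - 2) * (2 * a * y + a ^ 2))
      ≤ powerError p (a + y) := by
  have h0 : 0 < p * (p - 1) := mul_pos (by linarith) (by linarith)
  have h1 : p - 1 ≠ 0 := by linarith
  have h2 : p ≠ 0 := by linarith
  have h := div_le_div_of_nonneg_right (abs_rpow_add_le_abs_add_rpow hp y a) h0.le
  refine le_trans (le_of_eq ?_) h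
  rw [powerError]
  field_simp

lemma integrable_abs_rpow_gaussianReal {q : ℝ} (hq : 0 < q) (v : ℝ≥0) :
    Integrable (fun y : ℝ => |y| ^ q) (gaussianReal 0 v) := by
  have h := (memLp_id_gaussianReal (μ := 0) (v := v) q.toNNReal).integrable_norm_rpow
    (by simpa using hq) (by simp)
  simpa [Real.coe_toNNReal q hq.le] using h

lemma integrable_abs_rpow_mul_self_gaussianReal {q : ℝ} (hq : 0 < q) (v : ℝ≥0) :
    Integrable (fun y : ℝ => |y| ^ q * y) (gaussianReal 0 v) := by
  refine (integrable_abs_rpow_gaussianReal (q := q + 1) (by linarith) v).mono'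
    (by fun_prop) (Filter.Eventually.of_forall fun y => ?_)
  rw [norm_mul, Real.norm_of_nonneg (by positivity), Real.norm_eq_abs,
    Real.rpow_add_of_nonneg (abs_nonneg y) hq.le zero_le_one, Real.rpow_one]

lemma integral_abs_rpow_mul_self_gaussianReal (q : ℝ) (v : ℝ≥0) :
    ∫ y, |y| ^ q * y ∂(gaussianReal 0 v) = 0 := by
  have h : ∫ y, |y| ^ q * y ∂((gaussianReal 0 v).map fun y => -y)
      = ∫ y, |-y| ^ q * (-y) ∂(gaussianReal 0 v) :=
    integral_map (by fun_prop) (by fun_prop)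
  rw [gaussianReal_map_neg, neg_zero] at h
  simp only [abs_neg, mul_neg, integral_neg] at h
  linarith

lemma integral_abs_rpow_gaussianReal (q : ℝ) (σ : ℝ≥0) :
    ∫ y, |y| ^ q ∂(gaussianReal 0 (σ ^ 2)) = (σ : ℝ) ^ q * absMoment q := by
  have h : ∫ y, |y| ^ q ∂((gaussianReal 0 1).map fun y => (σ : ℝ) * y)
      = ∫ y, |(σ : ℝ) * y| ^ q ∂(gaussianReal 0 1) :=
    integral_map (by fun_prop) (Measurable.aestronglyMeasurable (by fun_prop))
  have hv : NNReal.mk ((σ : ℝ) ^ 2) (sq_nonneg _) = σ ^ 2 := rfl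
  rw [gaussianReal_map_const_mul, mul_zero, mul_one, hv] at h
  rw [h, absMoment, ← integral_const_mul]
  simp_rw [abs_mul, Real.mul_rpow (abs_nonneg _) (abs_nonneg _), abs_of_nonneg σ.coe_nonneg]

section Excess

variable {d : ℕ} {PX : Measure (EuclideanSpace ℝ (Fin d))} {σ : ℝ≥0} {p : ℝ}

lemma memLp_of_integrable_powerError (hp : 2 < p) {Δ : EuclideanSpace ℝ (Fin d)}
    (h : Integrable (fun z : EuclideanSpace ℝ (Fin d) × ℝ => powerError p (inner ℝ Δ z.1 + z.2))
      (PX.prod (gaussianReal 0 (σ ^ 2)))) :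
    MemLp (fun z : EuclideanSpace ℝ (Fin d) × ℝ => inner ℝ Δ z.1 + z.2) (ENNReal.ofReal p)
      (PX.prod (gaussianReal 0 (σ ^ 2))) := by
  have hp0 : 0 < p := by linarith
  have hpp : 0 < p * (p - 1) := mul_pos hp0 (by linarith)
  rw [← integrable_norm_rpow_iff (by fun_prop) (by simpa using hp0) ENNReal.ofReal_ne_top,
    ENNReal.toReal_ofReal hp0.le]
  refine (h.const_mul (p * (p - 1))).congr (Filter.Eventually.of_forall fun z => ?_)
  simp only [powerError, Real.norm_eq_abs]
  exact mul_div_cancel₀ _ hpp.ne'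

/-- Subtracting the case Δ = 0 removes the noise, which leaves ⟨Δ, X⟩ in L^p and hence in L². -/
lemma memLp_two_inner [IsProbabilityMeasure PX] (hp : 2 < p)
    (hfin : ∀ Δ : EuclideanSpace ℝ (Fin d),
      Integrable (fun z : EuclideanSpace ℝ (Fin d) × ℝ => powerError p (inner ℝ Δ z.1 + z.2))
        (PX.prod (gaussianReal 0 (σ ^ 2)))) (Δ : EuclideanSpace ℝ (Fin d)) :
    MemLp (fun x => inner ℝ Δ x) 2 PX := by
  have h := (memLp_of_integrable_powerError hp (hfin Δ)).sub
    (memLp_of_integrable_powerError hp (hfin 0))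
  have h2 := h.mono_exponent (p := 2) (by
    rw [show (2 : ℝ≥0∞) = ENNReal.ofReal 2 by simp]
    exact ENNReal.ofReal_le_ofReal hp.le)
  refine (memLp_map_measure_iff (μ := PX.prod (gaussianReal 0 (σ ^ 2))) (f := Prod.fst)
    (by fun_prop) (by fun_prop)).2 (h2.ae_eq (Filter.Eventually.of_forall fun z => ?_)) |> fun h3 => by
      rwa [measurePreserving_fst.map_eq] at h3
  simp

/-- Integrate `powerError_add_le` with y the noise: the cross term vanishes by independence and
symmetry. Only inf E ≤ E(wstar) is needed, not that wstar is a minimiser. -/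
lemma le_excessError [IsProbabilityMeasure PX] (hp : 2 < p)
    (hfin : ∀ Δ : EuclideanSpace ℝ (Fin d),
      Integrable (fun z : EuclideanSpace ℝ (Fin d) × ℝ => powerError p (inner ℝ Δ z.1 + z.2))
        (PX.prod (gaussianReal 0 (σ ^ 2)))) (wstar w : EuclideanSpace ℝ (Fin d)) :
    absMoment (p - 2) * (σ : ℝ) ^ (p - 2) / (2 * (p - 1)) * ∫ x, (inner ℝ (wstar - w) x) ^ 2 ∂PX
      ≤ excessError (powerError p) ((PX.prod (gaussianReal 0 (σ ^ 2))).map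
          fun z => (z.1, inner ℝ wstar z.1 + z.2)) w := by
  set μ := PX.prod (gaussianReal 0 (σ ^ 2)) with hμ
  have hexp : ∀ u, expectedError (powerError p) (μ.map fun z => (z.1, inner ℝ wstar z.1 + z.2)) u
      = ∫ z, powerError p (inner ℝ (wstar - u) z.1 + z.2) ∂μ := fun u => by
    have := measurable_powerError p
    rw [expectedError, integral_map (by fun_prop)
      (Measurable.aestronglyMeasurable (by fun_prop))]
    refine integral_congr_ae (Filter.Eventually.of_forall fun z => ?_)
    simp only
    rw [← powerError_neg, inner_sub_left]
    congr 1
    ring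
  have hinf : ⨅ u, expectedError (powerError p)
      (μ.map fun z => (z.1, inner ℝ wstar z.1 + z.2)) u
      ≤ ∫ z, powerError p (inner ℝ (0 : EuclideanSpace ℝ (Fin d)) z.1 + z.2) ∂μ := by
    rw [← sub_self wstar, ← hexp]
    refine ciInf_le ⟨0, ?_⟩ wstar
    rintro _ ⟨u, rfl⟩
    exact integral_nonneg fun _ => powerError_nonneg hp _
  rw [excessError, hexp]
  set Δ := wstar - w
  have hm := memLp_two_inner hp hfin Δ
  have i1 : Integrable (fun x => inner ℝ Δ x) PX := hm.integrable one_le_two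
  have i2 : Integrable (fun x => (inner ℝ Δ x) ^ 2) PX := hm.integrable_sq
  have g1 := integrable_abs_rpow_mul_self_gaussianReal (q := p - 2) (by linarith) (σ ^ 2)
  have g2 := integrable_abs_rpow_gaussianReal (q := p - 2) (by linarith) (σ ^ 2)
  have j1 : Integrable (fun z : EuclideanSpace ℝ (Fin d) × ℝ =>
      2 * (inner ℝ Δ z.1 * (|z.2| ^ (p - 2) * z.2))) μ := (i1.mul_prod g1).const_mul 2
  have j2 : Integrable (fun z : EuclideanSpace ℝ (Fin d) × ℝ =>
      (inner ℝ Δ z.1) ^ 2 * |z.2| ^ (p - 2)) μ := i2.mul_prod g2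
  have j3 : Integrable (fun z : EuclideanSpace ℝ (Fin d) × ℝ =>
      1 / (2 * (p - 1)) * (2 * (inner ℝ Δ z.1 * (|z.2| ^ (p - 2) * z.2))
        + (inner ℝ Δ z.1) ^ 2 * |z.2| ^ (p - 2))) μ := (j1.add j2).const_mul _
  have hI : ∫ z : EuclideanSpace ℝ (Fin d) × ℝ,
      1 / (2 * (p - 1)) * (2 * (inner ℝ Δ z.1 * (|z.2| ^ (p - 2) * z.2))
        + (inner ℝ Δ z.1) ^ 2 * |z.2| ^ (p - 2)) ∂μ
      = absMoment (p - 2) * (σ : ℝ) ^ (p - 2) / (2 * (p - 1))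
        * ∫ x, (inner ℝ Δ x) ^ 2 ∂PX := by
    rw [integral_const_mul, integral_add j1 j2, integral_const_mul, hμ,
      integral_prod_mul (fun x => inner ℝ Δ x) (fun y : ℝ => |y| ^ (p - 2) * y),
      integral_prod_mul (fun x => (inner ℝ Δ x) ^ 2) (fun y : ℝ => |y| ^ (p - 2)),
      integral_abs_rpow_mul_self_gaussianReal, integral_abs_rpow_gaussianReal]
    ring
  have hle : ∫ z, powerError p (inner ℝ (0 : EuclideanSpace ℝ (Fin d)) z.1 + z.2) ∂μ
      + absMoment (p - 2) * (σ : ℝ) ^ (p - 2) / (2 * (p - 1)) * ∫ x, (inner ℝ Δ x) ^ 2 ∂PX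
      ≤ ∫ z, powerError p (inner ℝ Δ z.1 + z.2) ∂μ := by
    rw [← hI, ← integral_add (hfin 0) j3]
    refine integral_mono ((hfin 0).add j3) (hfin Δ) fun z => ?_
    refine le_trans (le_of_eq ?_) (powerError_add_le hp z.2 (inner ℝ Δ z.1))
    simp only [inner_zero_left, zero_add]
    ring
  linarith

end Excess

/-! ### Whitening -/

/-- A vanishing integral would give full measure to a hyperplane, which is closed and so would
contain the support. -/
lemma integral_inner_sq_pos {d : ℕ} {PX : Measure (EuclideanSpace ℝ (Fin d))}
    (hPX : ∀ w : EuclideanSpace ℝ (Fin d), w ≠ 0 → ¬ PX.support ⊆ {x | inner ℝ w x = 0})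
    (hm : ∀ w : EuclideanSpace ℝ (Fin d), MemLp (fun x => inner ℝ w x) 2 PX)
    {w : EuclideanSpace ℝ (Fin d)} (hw : w ≠ 0) : 0 < ∫ x, (inner ℝ w x) ^ 2 ∂PX := by
  refine lt_of_le_of_ne (integral_nonneg fun _ => sq_nonneg _) fun h => hPX w hw ?_
  have h0 := (integral_eq_zero_iff_of_nonneg (fun _ => sq_nonneg _) (hm w).integrable_sq).1 h.symm
  refine Measure.support_subset_of_isClosed
    (isClosed_eq (by fun_prop) continuous_const) ?_
  filter_upwards [h0] with x hx
  exact pow_eq_zero_iff two_ne_zero |>.1 hx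

open scoped MatrixOrder Matrix.Norms.L2Operator in
lemma exists_linearEquiv_norm_sq_eq_integral {d : ℕ} {PX : Measure (EuclideanSpace ℝ (Fin d))}
    (hPX : ∀ w : EuclideanSpace ℝ (Fin d), w ≠ 0 → ¬ PX.support ⊆ {x | inner ℝ w x = 0})
    (hm : ∀ w : EuclideanSpace ℝ (Fin d), MemLp (fun x => inner ℝ w x) 2 PX) :
    ∃ G : EuclideanSpace ℝ (Fin d) ≃L[ℝ] EuclideanSpace ℝ (Fin d),
      ∀ w, ‖G w‖ ^ 2 = ∫ x, (inner ℝ w x) ^ 2 ∂PX := by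
  have hmi : ∀ i, MemLp (fun x : EuclideanSpace ℝ (Fin d) => x i) 2 PX := fun i => by
    simpa [EuclideanSpace.inner_single_left] using hm (EuclideanSpace.basisFun (Fin d) ℝ i)
  have hij : ∀ i j, Integrable (fun x : EuclideanSpace ℝ (Fin d) => x i * x j) PX := fun i j =>
    (hmi i).integrable_mul (hmi j)
  let M : Matrix (Fin d) (Fin d) ℝ := Matrix.of fun i j => ∫ x, x i * x j ∂PX
  have hM : ∀ w : Fin d → ℝ, w ⬝ᵥ (M.mulVec w)
      = ∫ x, (inner ℝ (WithLp.toLp 2 w) x) ^ 2 ∂PX := fun w => by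
    have h1 : ∀ x : EuclideanSpace ℝ (Fin d), (inner ℝ (WithLp.toLp 2 w) x) ^ 2
        = ∑ i, ∑ j, w i * w j * (x i * x j) := fun x => by
      simp only [PiLp.inner_apply, RCLike.inner_apply, conj_trivial]
      rw [sq, Finset.sum_mul_sum]
      exact Finset.sum_congr rfl fun i _ => Finset.sum_congr rfl fun j _ => by ring
    simp_rw [h1]
    rw [integral_finsetSum _ fun i _ => integrable_finsetSum _ fun j _ => (hij i j).const_mul _]
    simp only [dotProduct, Matrix.mulVec, Finset.mul_sum]
    refine Finset.sum_congr rfl fun i _ => ?_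
    rw [integral_finsetSum _ fun j _ => (hij i j).const_mul _]
    refine Finset.sum_congr rfl fun j _ => ?_
    rw [integral_const_mul]
    simp only [M, Matrix.of_apply]
    ring
  have hpsd : M.PosSemidef := by
    refine .of_dotProduct_mulVec_nonneg ?_ fun w => ?_
    · ext i j
      simp [M, mul_comm]
    · rw [star_trivial, hM]
      exact integral_nonneg fun _ => sq_nonneg _
  -- Any factor B with M = BᵀB works as G; it is injective because the form is definite.
  obtain ⟨B, hB⟩ := CStarAlgebra.nonneg_iff_eq_star_mul_self.1 hpsd.nonneg
  have hnorm : ∀ w, ‖Matrix.toEuclideanLin B w‖ ^ 2 = ∫ x, (inner ℝ w x) ^ 2 ∂PX := fun w => by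
    have h := hM w.ofLp
    rw [WithLp.toLp_ofLp] at h
    rw [← h, hB, Matrix.star_eq_conjTranspose, ← Matrix.mulVec_mulVec, Matrix.dotProduct_mulVec,
      Matrix.conjTranspose_eq_transpose_of_trivial, Matrix.vecMul_transpose,
      EuclideanSpace.real_norm_sq_eq]
    simp [dotProduct, Matrix.toLpLin_apply, sq]
  have hinj : Function.Injective (Matrix.toEuclideanLin B) := by
    rw [injective_iff_map_eq_zero]
    intro w hw
    by_contra hw0
    have h := integral_inner_sq_pos hPX hm hw0
    rw [← hnorm, hw] at h
    simp at h
  exact ⟨(LinearEquiv.ofInjectiveEndo _ hinj).toContinuousLinearEquiv, hnorm⟩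

end QuantileRegression

end

/-! ### Reduction of the minimax risk to estimation -/

open QuantileRegression in
theorem proposition2p8 (d n : ℕ) (hd : 0 < d) (hn : 0 < n)
    (PX : Measure (EuclideanSpace ℝ (Fin d))) [IsProbabilityMeasure PX]
    (hPX : ∀ w : EuclideanSpace ℝ (Fin d), w ≠ 0 → ¬ PX.support ⊆ {x | inner ℝ w x = 0})
    (σ : ℝ≥0) (hσ : 0 < σ) (p : ℝ) (hp : 2 < p) (δ : ℝ) (hδ : 0 < δ) (hδ' : δ < 1 / 2)
    (hfin : ∀ Δ : EuclideanSpace ℝ (Fin d),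
      Integrable (fun z : EuclideanSpace ℝ (Fin d) × ℝ =>
        QuantileRegression.powerError p (inner ℝ Δ z.1 + z.2))
        (PX.prod (gaussianReal 0 (σ ^ 2)))) :
    ENNReal.ofReal
        (QuantileRegression.absMoment (p - 2) / (16 * (p - 1)) *
          ((σ : ℝ) ^ p * ((d : ℝ) + Real.log (1 / δ)) / (n : ℝ)))
      ≤ QuantileRegression.minimaxRisk (QuantileRegression.powerError p) n δ
          (QuantileRegression.gaussClass PX σ) := by
  have hm := memLp_two_inner hp hfin
  obtain ⟨G, hG⟩ := exists_linearEquiv_norm_sq_eq_integral hPX hm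
  -- Whitened features: ⟨θ, φ x⟩ = ⟨G⁻¹θ, x⟩, so the parameter θ corresponds to wstar = G⁻¹θ.
  set φ : EuclideanSpace ℝ (Fin d) → EuclideanSpace ℝ (Fin d) :=
    fun x => ContinuousLinearMap.adjoint (G.symm : _ →L[ℝ] EuclideanSpace ℝ (Fin d)) x with hφ
  have hin : ∀ θ x, inner ℝ θ (φ x) = inner ℝ (G.symm θ) x := fun θ x => by
    rw [hφ, ContinuousLinearMap.adjoint_inner_right]; rfl
  have hiso : IsIsotropic PX φ := by
    refine ⟨by fun_prop, fun θ => ?_⟩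
    simp_rw [hin]
    exact ⟨(hm _).integrable_sq, by rw [← hG, G.apply_symm_apply]⟩
  refine le_iInf₂ fun what hwhat => ?_
  by_contra! hlt
  have hσ' : (0 : ℝ) < σ := hσ
  have hn' : (0 : ℝ) < n := by exact_mod_cast hn
  have hlog : 0 < Real.log (1 / δ) := Real.log_pos (by rw [lt_div_iff₀ hδ]; linarith)
  set t := ((σ ^ 2 : ℝ≥0) : ℝ) * (d + Real.log (1 / δ)) / (8 * n) with ht
  have ht0 : 0 < t := by positivity
  set κ := absMoment (p - 2) * (σ : ℝ) ^ (p - 2) / (2 * (p - 1)) with hκ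
  have hB : absMoment (p - 2) / (16 * (p - 1)) *
      ((σ : ℝ) ^ p * ((d : ℝ) + Real.log (1 / δ)) / (n : ℝ)) = κ * t := by
    have h2 : (σ : ℝ) ^ p = (σ : ℝ) ^ (p - 2) * (σ : ℝ) ^ 2 := by
      rw [← Real.rpow_natCast, ← Real.rpow_add hσ']; congr 1; push_cast; ring
    have h1 : p - 1 ≠ 0 := by linarith
    rw [h2, hκ, ht]
    push_cast
    field_simp
    ring
  rw [hB] at hlt
  refine not_isAccurate hiso hd hn (pow_ne_zero 2 hσ.ne') hδ hδ'
    (est := fun D => G (what D)) (G.continuous.measurable.comp hwhat) fun θ => ?_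
  have hP : shiftedLaw PX (σ ^ 2) φ θ ∈ gaussClass PX σ :=
    ⟨G.symm θ, by simp_rw [shiftedLaw, hin]⟩
  have hq := (le_iSup₂ (f := fun P (_ : P ∈ gaussClass PX σ) =>
    quantileRisk (powerError p) n δ P what) _ hP).trans_lt hlt
  -- Since the risk is strictly below κt, some admissible level s is too; the strictness puts θ in
  -- the open ball.
  simp only [quantileRisk, iInf_lt_iff] at hq
  obtain ⟨s, hs, hst⟩ := hq
  refine hs.trans (measure_mono fun D hD => ?_)
  have hst' : (s : ℝ) < κ * t := by
    have := ENNReal.toReal_lt_of_lt_ofReal hst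
    simpa using this
  -- Positivity of κ is read off from 0 ≤ s < κt, so the absolute moment need not be shown positive.
  have hκ0 : 0 < κ := (pos_iff_pos_of_mul_pos (s.coe_nonneg.trans_lt hst')).2 ht0
  have hex := le_excessError hp hfin (G.symm θ) (what D)
  rw [← hG, map_sub, G.apply_symm_apply, ← hκ] at hex
  have hD' : excessError (powerError p) (shiftedLaw PX (σ ^ 2) φ θ) (what D) ≤ s := hD
  simp_rw [shiftedLaw, hin] at hD'
  have hlt' : ‖θ - G (what D)‖ ^ 2 < t := by
    have := (hex.trans hD').trans_lt hst'
    exact lt_of_mul_lt_mul_left this hκ0.le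
  change dist θ (G (what D)) < √t
  rw [dist_eq_norm]
  exact Real.lt_sqrt_of_sq_lt hlt'
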